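/- Let $R$ be a commutative ring and $\underline{x}=x_1,\dots,x_r$ a finite sequence of elements of $R$. Write $\underline{x}^{(n)}=x_1^n,\dots,x_r^n$, let $H_i(\underline{x}^{(n)};R)$ denote Koszul homology, and let $\Lambda^{\underline{x}}(M)=\varprojlim_n M/(\underline{x}R)^nM$ be the $\underline{x}R$-adic completion of an $R$-module $M$. The sequence $\underline{x}$ is called $R$-weakly pro-regular if for every $i>0$ and every $n$ there is an $m\ge n$ such that the natural map $H_i(\underline{x}^{(m)};R)\to H_i(\underline{x}^{(n)};R)$ is zero. Let $\mathcal{L}_{\underline{x}}$ be the bounded free resolution of the Čech complex $\check{C}_{\underline{x}}=\bigotimes_{i=1}^r(0\to R\to R_{x_i}\to 0)$ given by the Koszul co-complex $K^\bullet(\underline{x}-\underline{U};R[\underline{U}^{-1}])$ of the commuting endomorphisms $x_i-U_i$ of the module of inverse polynomials $R[\underline{U}^{-1}]=\bigoplus_{\alpha\in\mathbb{N}^r}R\,U^{-\alpha}$, where $U_i\cdot U^{-\alpha}=U^{-(\alpha-e_i)}$ if $\alpha_i\ge 1$ and $U_i\cdot U^{-\alpha}=0$ if $\alpha_i=0$.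 The complex $\mathrm{Hom}_R(\mathcal{L}_{\underline{x}},M)$ is graded homologically, with $\mathrm{Hom}_R(\mathcal{L}^p_{\underline{x}},M)$ in degree $p$. A complex $X:\cdots\to X_1\to X_0\to 0$ of $R$-modules is called a left resolution of an $R$-module $N$ if there is a quasi-isomorphism $X\to N$, where $N$ is regarded as a complex concentrated in degree $0$. Then the following conditions are equivalent: (i) $\underline{x}$ is $R$-weakly pro-regular. (ii) $\mathrm{Hom}_R(\mathcal{L}_{\underline{x}},M)$ is a left resolution of $\Lambda^{\underline{x}}(M)$ for every free $R$-module $M$. (iii) $\mathrm{Hom}_R(\mathcal{L}_{\underline{x}},R[T])$ is a left resolution of $\Lambda^{\underline{x}}(R[T])$. -/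

import Mathlib

open CategoryTheory

universe u v w

namespace WeakProreg

/-! ### Signs -/

/-- The sign of the position of `i` relative to a set `T`: `(-1) ^ #{k ∈ T | k < i}`. -/
def koszulSign {r : ℕ} (i : Fin r) (T : Finset (Fin r)) : ℤ :=
  (-1) ^ (T.filter (fun k => k < i)).card

theorem koszulSign_swap {r : ℕ} {i j : Fin r} (hij : i ≠ j) {T : Finset (Fin r)}
    (hi : i ∉ T) (hj : j ∉ T) :
    koszulSign i T * koszulSign j (insert i T) =
      -(koszulSign j T * koszulSign i (insert j T)) := by
  unfold koszulSign
  rw [Finset.filter_insert, Finset.filter_insert]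
  rcases lt_or_gt_of_ne hij with h | h
  · rw [if_pos h, if_neg (not_lt.mpr h.le), Finset.card_insert_of_notMem (by simp [hi])]
    ring
  · rw [if_neg (not_lt.mpr h.le), if_pos h, Finset.card_insert_of_notMem (by simp [hj])]
    ring

/-- The subsets of `{1, …, r}` with `p` elements. They index the standard basis
`e_S = e_{i_1} ∧ ⋯ ∧ e_{i_p}`, `S = {i_1 < ⋯ < i_p}`, of the `p`-th exterior power of `R ^ r`. -/
abbrev Subsets (r p : ℕ) : Type := {S : Finset (Fin r) // S.card = p}

/-- The set `T ∪ {i}` for `i ∉ T`. -/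
def Subsets.insert {r p : ℕ} (T : Subsets r p) (i : {i : Fin r // i ∉ T.1}) :
    Subsets r (p + 1) :=
  ⟨Insert.insert i.1 T.1, by rw [Finset.card_insert_of_notMem i.2, T.2]⟩

/-- The set `S \ {i}` for `i ∈ S`. -/
def Subsets.erase {r p : ℕ} (S : Subsets r (p + 1)) (i : {i : Fin r // i ∈ S.1}) :
    Subsets r p :=
  ⟨S.1.erase i.1, by rw [Finset.card_erase_of_mem i.2, S.2, Nat.add_sub_cancel]⟩

section Koszul

variable {R : Type u} [CommRing R] {r : ℕ}

/-! ### The Koszul complex -/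

/-- The differential `K_{p+1}(x; M) → K_p(x; M)` of the Koszul complex. A family
`f : Subsets r (p + 1) → M` stands for the element `∑ e_S ⊗ f S`, and
`d (e_{i_0} ∧ ⋯ ∧ e_{i_p} ⊗ m) = ∑_k (-1) ^ k e_{i_0} ∧ ⋯ ê_{i_k} ⋯ ∧ e_{i_p} ⊗ x_{i_k} m`. -/
def koszulD (x : Fin r → R) (M : Type w) [AddCommGroup M] [Module R M] (p : ℕ) :
    (Subsets r (p + 1) → M) →ₗ[R] (Subsets r p → M) where
  toFun f T := ∑ i : {i : Fin r // i ∉ T.1}, koszulSign i.1 T.1 • x i.1 • f (T.insert i)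
  map_add' f g := by
    ext T
    simp [Finset.sum_add_distrib]
  map_smul' c f := by
    ext T
    simp only [Pi.smul_apply, RingHom.id_apply, Finset.smul_sum]
    refine Finset.sum_congr rfl fun i _ => ?_
    rw [smul_comm c, smul_comm c]

theorem koszulD_comp (x : Fin r → R) (M : Type w) [AddCommGroup M] [Module R M] (p : ℕ) :
    koszulD x M p ∘ₗ koszulD x M (p + 1) = 0 := by
  refine LinearMap.ext fun f => funext fun T => ?_
  simp only [LinearMap.comp_apply, koszulD, LinearMap.coe_mk, AddHom.coe_mk,
    LinearMap.zero_apply, Pi.zero_apply, Finset.smul_sum]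
  rw [Finset.sum_sigma']
  refine Finset.sum_involution
    (fun a _ => ⟨⟨a.2.1, fun h => a.2.2 (Finset.mem_insert_of_mem h)⟩,
      ⟨a.1.1, fun h => (Finset.mem_insert.mp h).elim
        (fun e => a.2.2 (Finset.mem_insert.mpr (Or.inl e.symm))) a.1.2⟩⟩) ?_ ?_ ?_ ?_
  · rintro ⟨⟨i, hi⟩, ⟨j, hj⟩⟩ -
    have hij : i ≠ j := fun e => hj (Finset.mem_insert.mpr (Or.inl e.symm))
    have hj' : j ∉ T.1 := fun h => hj (Finset.mem_insert_of_mem h)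
    have hs := koszulSign_swap hij hi hj'
    have he : ((T.insert ⟨i, hi⟩).insert ⟨j, hj⟩ : Subsets r (p + 1 + 1)) =
        (T.insert ⟨j, hj'⟩).insert ⟨i, fun h => (Finset.mem_insert.mp h).elim hij hi⟩ :=
      Subtype.ext (Finset.insert_comm _ _ _)
    have key : ∀ (a b : ℤ) (y z : R) (m : M),
        a • y • b • z • m = (a * b) • (y * z) • m := by
      intro a b y z m
      rw [smul_comm y b, smul_smul, smul_smul]
    dsimp only
    rw [key, key, he, mul_comm (x j)]
    change (koszulSign i T.1 * koszulSign j (Insert.insert i T.1)) • _ +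
      (koszulSign j T.1 * koszulSign i (Insert.insert j T.1)) • _ = _
    rw [hs, neg_smul, neg_add_cancel]
  · rintro ⟨⟨i, hi⟩, ⟨j, hj⟩⟩ - - h
    have h1 : j = i := congrArg (fun a => a.1.1) h
    exact hj (Finset.mem_insert.mpr (Or.inl h1))
  · intros
    exact Finset.mem_univ _
  · intros
    rfl

/-- The Koszul complex `K_•(x; M)` of a sequence `x = x_1, …, x_r` with coefficients in `M`. -/
noncomputable def koszulComplex (x : Fin r → R) (M : Type w) [AddCommGroup M] [Module R M] :
    ChainComplex (ModuleCat.{w} R) ℕ :=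
  ChainComplex.of (fun p => ModuleCat.of R (Subsets r p → M))
    (fun p => ModuleCat.ofHom (koszulD x M p))
    (fun p => by
      rw [← ModuleCat.ofHom_comp, koszulD_comp]
      rfl)

/-- In degree `p`, the natural map `K_•(x^(m); M) → K_•(x^(n); M)`, where `n ≤ m` and
`x^(n) = x_1 ^ n, …, x_r ^ n`; it sends `e_S ⊗ a` to `e_S ⊗ (∏_{i ∈ S} x_i ^ (m - n)) a`. -/
def koszulPowMapX (x : Fin r → R) (M : Type w) [AddCommGroup M] [Module R M] (n m p : ℕ) :
    (Subsets r p → M) →ₗ[R] (Subsets r p → M) where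
  toFun f S := (∏ i ∈ S.1, x i ^ (m - n)) • f S
  map_add' f g := by
    ext S
    simp
  map_smul' c f := by
    ext S
    simp [smul_comm c]

theorem koszulPowMapX_comm (x : Fin r → R) (M : Type w) [AddCommGroup M] [Module R M]
    {n m : ℕ} (h : n ≤ m) (p : ℕ) :
    koszulD (fun i => x i ^ n) M p ∘ₗ koszulPowMapX x M n m (p + 1) =
      koszulPowMapX x M n m p ∘ₗ koszulD (fun i => x i ^ m) M p := by
  refine LinearMap.ext fun f => funext fun T => ?_
  simp only [LinearMap.comp_apply, koszulD, koszulPowMapX, LinearMap.coe_mk, AddHom.coe_mk,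
    Finset.smul_sum]
  refine Finset.sum_congr rfl fun i _ => ?_
  rw [smul_comm (∏ i ∈ T.1, x i ^ (m - n))]
  congr 1
  simp only [Subsets.insert, smul_smul]
  rw [Finset.prod_insert i.2, ← mul_assoc, ← pow_add, Nat.add_sub_cancel' h, mul_comm]

/-- The natural map `K_•(x^(m); M) → K_•(x^(n); M)` of Koszul complexes for `n ≤ m`. -/
noncomputable def koszulPowMap (x : Fin r → R) (M : Type w) [AddCommGroup M] [Module R M]
    {n m : ℕ} (h : n ≤ m) :
    koszulComplex (fun i => x i ^ m) M ⟶ koszulComplex (fun i => x i ^ n) M :=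
  ChainComplex.ofHom (fun p => ModuleCat.ofHom (koszulPowMapX x M n m p))
    (fun p => by
      simp only [koszulComplex, ChainComplex.of_d]
      rw [← ModuleCat.ofHom_comp, ← ModuleCat.ofHom_comp, koszulPowMapX_comm x M h])

/-- The sequence `x` is `M`-weakly pro-regular: for each `i > 0` the inverse system of Koszul
homology modules `{H_i(x^(n); M)}_n` is pro-zero, i.e. for each `n` there is an `m ≥ n` such that
the natural map `H_i(x^(m); M) → H_i(x^(n); M)` is zero. -/
def IsWeaklyProregular (x : Fin r → R) (M : Type w) [AddCommGroup M] [Module R M] : Prop :=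
  ∀ i : ℕ, 0 < i → ∀ n : ℕ, ∃ (m : ℕ) (h : n ≤ m),
    HomologicalComplex.homologyMap (koszulPowMap x M h) i = 0

/-! ### Koszul co-complexes -/

/-- The differential `K^p(φ; N) → K^{p+1}(φ; N)` of the Koszul co-complex of a sequence of
endomorphisms `φ_1, …, φ_r` of `N`:
`(d f) {i_0 < ⋯ < i_p} = ∑_k (-1) ^ k φ_{i_k} (f {i_0, …, i_p without i_k})`. -/
def koszulCoD {N : Type w} [AddCommGroup N] [Module R N] (φ : Fin r → Module.End R N) (p : ℕ) :
    (Subsets r p → N) →ₗ[R] (Subsets r (p + 1) → N) where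
  toFun f S := ∑ i : {i : Fin r // i ∈ S.1}, koszulSign i.1 S.1 • φ i.1 (f (S.erase i))
  map_add' f g := by
    ext S
    simp [Finset.sum_add_distrib]
  map_smul' c f := by
    ext S
    simp only [Pi.smul_apply, RingHom.id_apply, Finset.smul_sum, map_smul]
    refine Finset.sum_congr rfl fun i _ => ?_
    rw [smul_comm c]

theorem koszulSign_erase (i : Fin r) (S : Finset (Fin r)) :
    koszulSign i S = koszulSign i (S.erase i) := by
  unfold koszulSign
  congr 2
  ext k
  simp only [Finset.mem_filter, Finset.mem_erase]
  exact ⟨fun h => ⟨⟨h.2.ne, h.1⟩, h.2⟩, fun h => ⟨h.1.2, h.2⟩⟩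

theorem koszulSign_swap_erase {i j : Fin r} (hij : i ≠ j) {S : Finset (Fin r)}
    (hi : i ∈ S) (hj : j ∈ S) :
    koszulSign i S * koszulSign j (S.erase i) =
      -(koszulSign j S * koszulSign i (S.erase j)) := by
  have h := koszulSign_swap (T := (S.erase i).erase j) hij (by simp) (by simp)
  have h1 : insert j ((S.erase i).erase j) = S.erase i :=
    Finset.insert_erase (Finset.mem_erase.mpr ⟨hij.symm, hj⟩)
  have h2 : insert i ((S.erase i).erase j) = S.erase j := by
    rw [Finset.erase_right_comm]
    exact Finset.insert_erase (Finset.mem_erase.mpr ⟨hij, hi⟩)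
  rw [h1, h2, ← koszulSign_erase j (S.erase i), Finset.erase_right_comm,
    ← koszulSign_erase i (S.erase j), ← koszulSign_erase i S, ← koszulSign_erase j S] at h
  linarith

theorem koszulCoD_comp {N : Type w} [AddCommGroup N] [Module R N] (φ : Fin r → Module.End R N)
    (hφ : ∀ i j, Commute (φ i) (φ j)) (p : ℕ) :
    koszulCoD φ (p + 1) ∘ₗ koszulCoD φ p = 0 := by
  refine LinearMap.ext fun f => funext fun S => ?_
  simp only [LinearMap.comp_apply, koszulCoD, LinearMap.coe_mk, AddHom.coe_mk,
    LinearMap.zero_apply, Pi.zero_apply, map_sum, Finset.smul_sum]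
  rw [Finset.sum_sigma']
  refine Finset.sum_involution
    (fun a _ => ⟨⟨a.2.1, Finset.mem_of_mem_erase a.2.2⟩,
      ⟨a.1.1, Finset.mem_erase.mpr ⟨fun e => (Finset.mem_erase.mp a.2.2).1 e.symm, a.1.2⟩⟩⟩)
    ?_ ?_ ?_ ?_
  · rintro ⟨⟨i, hi⟩, ⟨j, hj⟩⟩ -
    have hij : i ≠ j := fun e => (Finset.mem_erase.mp hj).1 e.symm
    have hj' : j ∈ S.1 := Finset.mem_of_mem_erase hj
    have hs := koszulSign_swap_erase hij hi hj'
    have he : ((S.erase ⟨i, hi⟩).erase ⟨j, hj⟩ : Subsets r p) =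
        (S.erase ⟨j, hj'⟩).erase ⟨i, Finset.mem_erase.mpr ⟨hij, hi⟩⟩ :=
      Subtype.ext Finset.erase_right_comm
    have hc : ∀ z, φ i (φ j z) = φ j (φ i z) := fun z => LinearMap.congr_fun (hφ i j).eq z
    dsimp only
    rw [map_zsmul, map_zsmul, smul_smul, smul_smul, he, hc]
    change (koszulSign i S.1 * koszulSign j (S.1.erase i)) • _ +
      (koszulSign j S.1 * koszulSign i (S.1.erase j)) • _ = _
    rw [hs, neg_smul, neg_add_cancel]
  · rintro ⟨⟨i, hi⟩, ⟨j, hj⟩⟩ - - h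
    have h1 : j = i := congrArg (fun a => a.1.1) h
    exact (Finset.mem_erase.mp hj).1 h1
  · intros
    exact Finset.mem_univ _
  · intros
    rfl

/-- The Koszul co-complex `K^•(φ; N)` of pairwise commuting endomorphisms `φ_1, …, φ_r` of `N`. -/
noncomputable def koszulCocomplex {N : Type w} [AddCommGroup N] [Module R N]
    (φ : Fin r → Module.End R N) (hφ : ∀ i j, Commute (φ i) (φ j)) :
    CochainComplex (ModuleCat.{w} R) ℕ :=
  CochainComplex.of (fun p => ModuleCat.of R (Subsets r p → N))
    (fun p => ModuleCat.ofHom (koszulCoD φ p))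
    (fun p => by
      rw [← ModuleCat.ofHom_comp, koszulCoD_comp φ hφ]
      rfl)

/-! ### The free resolution of the Čech complex -/

variable (R r) in
/-- The module `R[U⁻¹] = R[U_1⁻¹, …, U_r⁻¹]` of inverse polynomials: the free `R`-module on the
monomials `U ^ (-α)`, `α ∈ ℕ ^ r`. An element is given by its family of coefficients. -/
abbrev InvPoly : Type u := (Fin r →₀ ℕ) →₀ R

variable (R) in
/-- Multiplication by the variable `U_i` on `R[U⁻¹]`: the monomial `U ^ (-α)` goes to
`U ^ (-(α - e_i))` if `α_i ≥ 1`, and to `0` if `α_i = 0`. On coefficients,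
`(U_i g)_β = g_{β + e_i}`. -/
noncomputable def mulU (i : Fin r) : Module.End R (InvPoly R r) :=
  Finsupp.lcomapDomain (fun β => β + Finsupp.single i 1) (add_left_injective _)

/-- Multiplication by `x_i - U_i` on `R[U⁻¹]`. -/
noncomputable def mulXSubU (x : Fin r → R) (i : Fin r) : Module.End R (InvPoly R r) :=
  x i • LinearMap.id - mulU R i

theorem mulXSubU_commute (x : Fin r → R) (i j : Fin r) :
    Commute (mulXSubU x i) (mulXSubU x j) := by
  have h : Commute (mulU R i) (mulU R j) := by
    refine LinearMap.ext fun g => Finsupp.ext fun β => ?_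
    change g (β + Finsupp.single i 1 + Finsupp.single j 1) =
      g (β + Finsupp.single j 1 + Finsupp.single i 1)
    rw [add_right_comm]
  refine LinearMap.ext fun g => ?_
  have hg : mulU R i (mulU R j g) = mulU R j (mulU R i g) := LinearMap.congr_fun h.eq g
  change x i • (x j • g - mulU R j g) - mulU R i (x j • g - mulU R j g) =
    x j • (x i • g - mulU R i g) - mulU R j (x i • g - mulU R i g)
  rw [map_sub, map_sub, map_smul, map_smul, hg, smul_sub, smul_sub, smul_comm (x i) (x j) g]
  abel

/-- The bounded complex of free `R`-modules `𝓛_x`, the free resolution of the Čech complex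
`Č_x = Č_{x_1} ⊗ ⋯ ⊗ Č_{x_r}`, `Č_{x_i} : 0 → R → R_{x_i} → 0`. It is the Koszul co-complex
`K^•(x - U; R[U⁻¹])`, that is, the tensor product `𝓛_{x_1} ⊗ ⋯ ⊗ 𝓛_{x_r}` of the complexes
`𝓛_{x_i} : 0 → R[U_i⁻¹] → R[U_i⁻¹] → 0` in degrees `0` and `1` with differential `x_i - U_i`.
The quasi-isomorphism `𝓛_{x_i} → Č_{x_i}` is `∑ a_k U_i ^ (-k) ↦ a_0` in degree `0` and
`∑ a_k U_i ^ (-k) ↦ ∑ a_k / x_i ^ (k + 1)` in degree `1`. -/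
noncomputable def cechResolution (x : Fin r → R) : CochainComplex (ModuleCat.{u} R) ℕ :=
  koszulCocomplex (mulXSubU x) (mulXSubU_commute x)

/-- The complex `Hom_R(L, M)` for a complex `L : 0 → L^0 → L^1 → ⋯` and a module `M`. It is
written homologically: `Hom_R(L^p, M)` sits in homological degree `p`, and the differential
`Hom_R(L^{p+1}, M) → Hom_R(L^p, M)` is composition with `L^p → L^{p+1}`. -/
noncomputable def homComplex (L : CochainComplex (ModuleCat.{u} R) ℕ)
    (M : Type w) [AddCommGroup M] [Module R M] : ChainComplex (ModuleCat.{max u w} R) ℕ where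
  X p := ModuleCat.of R (L.X p →ₗ[R] M)
  d i j := ModuleCat.ofHom (LinearMap.lcomp R M (L.d j i).hom)
  shape i j h := by
    rw [L.shape j i h]
    ext
    simp
  d_comp_d' i j k _ _ := by
    rw [← ModuleCat.ofHom_comp]
    ext f : 2
    change (f ∘ₗ (L.d j i).hom) ∘ₗ (L.d k j).hom = 0
    rw [LinearMap.comp_assoc, ← ModuleCat.hom_comp, L.d_comp_d]
    simp

/-- A complex `X : ⋯ → X_1 → X_0 → 0` is a left resolution of the module `N` if there is a
quasi-isomorphism `X → N`, where `N` is viewed as a complex concentrated in degree `0`. -/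
def IsLeftResolution (X : ChainComplex (ModuleCat.{w} R) ℕ)
    (N : Type w) [AddCommGroup N] [Module R N] : Prop :=
  ∃ f : X ⟶ (ChainComplex.single₀ (ModuleCat.{w} R)).obj (ModuleCat.of R N), QuasiIso f

/-- The `xR`-adic completion `Λ^x(M)` of `M`. -/
abbrev completion (x : Fin r → R) (M : Type w) [AddCommGroup M] [Module R M] : Type w :=
  AdicCompletion (Ideal.span (Set.range x)) M

end Koszul

end WeakProreg

namespace WeakProreg

/-! ### The total Koszul complex of commuting endomorphisms -/

/-! A functional on `R[U⁻¹]` is a formal power series, so `Hom_R(𝓛_x, M)` is the Koszul complex of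
`x - U` on `M[[U]]`, the inverse limit of its truncations modulo `(U_1 ^ n, …, U_r ^ n)`. Each
truncation retracts onto `K(x^(n); M)`. In one variable, division by `U - x` leaves a constant in
degree `0`, while in degree `1` one keeps the multiples of `∑ x ^ (n - 1 - k) U ^ k`, whose product
with `x - U` is `x ^ n - U ^ n`. The homotopy is a divided difference, and truncation corresponds to
the natural maps of Koszul complexes. Hence weak pro-regularity says that the positive homology of
the truncations is pro-zero (`KoszulProZero.seriesProZero`, `SeriesProZero.koszulProZero`), and it
passes from `R` to free modules coordinatewise.

If these systems are pro-zero, a Mittag-Leffler argument (`SeriesProZero.exists_seriesD_eq`) turns a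
boundary modulo every truncation into a boundary. This kills the positive homology of the limit. In
degree `0`, evaluation at `x` always maps `M[[U]]` onto the completion, and the same argument
identifies its kernel with `(x - U) M[[U]]`.

Conversely, let `M` be free of countable rank and suppose that the system in some degree is not
pro-zero. Place the boundaries of the bad truncated cycles in different coordinates of `M`. Their
sum converges in `M[[U]]` and is a boundary modulo every truncation, hence a boundary, by exactness
or, in degree `0`, because the completion is separated. A primitive involves only finitely many
coordinates below a given truncation, so some bad cycle is trivial there, a contradiction
(`seriesProZero_of_limit`). -/

theorem koszulSign_mul_self {r : ℕ} (i : Fin r) (T : Finset (Fin r)) :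
    koszulSign i T * koszulSign i T = 1 := by
  unfold koszulSign
  rw [← mul_pow]
  simp

section Total

variable {R : Type u} [CommRing R] {r : ℕ} {N : Type w} [AddCommGroup N] [Module R N]

/-- The differential of the Koszul complex `K_•(φ; N)` of a sequence of endomorphisms of `N`, on
all degrees at once: the elements of degree `p` are the families supported on the sets with `p`
elements. -/
def totalD (φ : Fin r → Module.End R N) :
    (Finset (Fin r) → N) →ₗ[R] (Finset (Fin r) → N) where
  toFun a T := ∑ i ∈ Tᶜ, koszulSign i T • φ i (a (insert i T))
  map_add' a b := by
    ext T
    simp [Finset.sum_add_distrib]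
  map_smul' c a := by
    ext T
    simp only [Pi.smul_apply, RingHom.id_apply, Finset.smul_sum, map_smul]
    exact Finset.sum_congr rfl fun i _ => smul_comm _ _ _

theorem totalD_apply (φ : Fin r → Module.End R N) (a : Finset (Fin r) → N) (T : Finset (Fin r)) :
    totalD φ a T = ∑ i ∈ Tᶜ, koszulSign i T • φ i (a (insert i T)) := rfl

theorem totalD_congr (φ : Fin r → Module.End R N) {a b : Finset (Fin r) → N} {p : ℕ}
    (h : ∀ S, S.card = p + 1 → a S = b S) {T : Finset (Fin r)} (hT : T.card = p) :
    totalD φ a T = totalD φ b T := by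
  rw [totalD_apply, totalD_apply]
  refine Finset.sum_congr rfl fun i hi => ?_
  rw [h _ (by rw [Finset.card_insert_of_notMem (Finset.mem_compl.mp hi), hT])]

theorem totalD_totalD (φ : Fin r → Module.End R N) (hφ : ∀ i j, Commute (φ i) (φ j))
    (a : Finset (Fin r) → N) : totalD φ (totalD φ a) = 0 := by
  refine funext fun T => ?_
  simp only [totalD_apply, map_sum, Finset.smul_sum, Pi.zero_apply]
  rw [Finset.sum_sigma']
  have hc : ∀ i j z, φ i (φ j z) = φ j (φ i z) := fun i j z => LinearMap.congr_fun (hφ i j).eq z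
  refine Finset.sum_involution (fun a _ => ⟨a.2, a.1⟩) ?_ ?_ ?_ ?_
  · rintro ⟨i, j⟩ hij
    simp only [Finset.mem_sigma, Finset.mem_compl, Finset.mem_insert, not_or] at hij
    obtain ⟨hi, hji, hj⟩ := hij
    have hs := koszulSign_swap (Ne.symm hji) hi hj
    dsimp only
    rw [map_zsmul, map_zsmul, smul_smul, smul_smul, hc i j, Finset.insert_comm j i, hs, neg_smul,
      neg_add_cancel]
  · rintro ⟨i, j⟩ hij - h
    simp only [Finset.mem_sigma, Finset.mem_compl, Finset.mem_insert, not_or] at hij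
    exact hij.2.1 (congrArg Sigma.fst h)
  · rintro ⟨i, j⟩ hij
    simp only [Finset.mem_sigma, Finset.mem_compl, Finset.mem_insert, not_or] at hij ⊢
    exact ⟨hij.2.2, fun h => hij.2.1 h.symm, hij.1⟩
  · intros
    rfl

/-- The operator on the Koszul complex given by left exterior multiplication with `e_i` and an
endomorphism `h` of the coefficients. -/
def wedge (i : Fin r) (h : Module.End R N) :
    (Finset (Fin r) → N) →ₗ[R] (Finset (Fin r) → N) where
  toFun a S := if i ∈ S then koszulSign i S • h (a (S.erase i)) else 0
  map_add' a b := by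
    ext S
    simp only [Pi.add_apply, map_add, smul_add]
    split_ifs <;> simp
  map_smul' c a := by
    ext S
    simp only [Pi.smul_apply, map_smul, RingHom.id_apply]
    split_ifs
    · exact smul_comm _ _ _
    · simp

theorem wedge_apply (i : Fin r) (h : Module.End R N) (a : Finset (Fin r) → N)
    (S : Finset (Fin r)) :
    wedge i h a S = if i ∈ S then koszulSign i S • h (a (S.erase i)) else 0 := rfl

/-- Cartan's homotopy formula: for `j ≠ i` the terms through `φ j` occur twice with opposite signs,
because `h` commutes with `φ j`, and only the terms through `φ i` survive. -/
theorem totalD_wedge_add (φ : Fin r → Module.End R N) (i : Fin r) (h : Module.End R N)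
    (hc : ∀ j, j ≠ i → ∀ z, φ j (h z) = h (φ j z)) (a : Finset (Fin r) → N)
    (T : Finset (Fin r)) :
    totalD φ (wedge i h a) T + wedge i h (totalD φ a) T =
      if i ∈ T then h (φ i (a T)) else φ i (h (a T)) := by
  by_cases hi : i ∈ T
  · have hi' : i ∉ T.erase i := Finset.notMem_erase i T
    have hT : insert i (T.erase i) = T := Finset.insert_erase hi
    rw [if_pos hi, wedge_apply, if_pos hi, totalD_apply, totalD_apply, Finset.compl_erase,
      Finset.sum_insert (by simpa using hi), hT, ← koszulSign_erase, map_add, map_zsmul, smul_add,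
      smul_smul, koszulSign_mul_self, one_smul, map_sum, Finset.smul_sum]
    rw [add_left_comm, ← Finset.sum_add_distrib, Finset.sum_eq_zero, add_zero]
    intro j hj
    have hj : j ∉ T := Finset.mem_compl.mp hj
    have hij : i ≠ j := fun e => hj (e ▸ hi)
    have he : (insert j T).erase i = insert j (T.erase i) :=
      Finset.erase_insert_of_ne (fun e => hij e.symm)
    have hs := koszulSign_swap hij hi' (T := T.erase i) (j := j)
      (fun h => hj (Finset.mem_of_mem_erase h))
    rw [hT, ← koszulSign_erase, ← he, ← koszulSign_erase] at hs
    rw [wedge_apply, if_pos (Finset.mem_insert_of_mem hi), map_zsmul, map_zsmul,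
      hc j hij.symm, he, smul_smul, smul_smul, ← add_smul]
    have e1 := koszulSign_mul_self i T
    have e2 := koszulSign_mul_self i (insert j T)
    have : koszulSign j T * koszulSign i (insert j T) +
        koszulSign i T * koszulSign j (T.erase i) = 0 := by
      linear_combination (koszulSign i T * koszulSign i (insert j T)) * hs
        - (koszulSign j T * koszulSign i (insert j T)) * e1
        - (koszulSign i T * koszulSign j (T.erase i)) * e2
    rw [this, zero_smul]
  · rw [if_neg hi, wedge_apply, if_neg hi, add_zero, totalD_apply,
      Finset.sum_eq_single_of_mem i (Finset.mem_compl.mpr hi), wedge_apply,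
      if_pos (Finset.mem_insert_self _ _), Finset.erase_insert hi, map_zsmul, smul_smul,
      koszulSign_erase i (insert i T), Finset.erase_insert hi, koszulSign_mul_self, one_smul]
    intro j hj hji
    rw [wedge_apply, if_neg, map_zero, smul_zero]
    rw [Finset.mem_insert, not_or]
    exact ⟨fun e => hji e.symm, hi⟩

/-- The chain endomorphism `1 - (d h + h d)` of the Koszul complex, where `h` is the operator
`wedge i h`. -/
def contract (φ : Fin r → Module.End R N) (i : Fin r) (h : Module.End R N) :
    (Finset (Fin r) → N) →ₗ[R] (Finset (Fin r) → N) :=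
  LinearMap.id - (totalD φ ∘ₗ wedge i h + wedge i h ∘ₗ totalD φ)

theorem contract_eq (φ : Fin r → Module.End R N) (i : Fin r) (h : Module.End R N)
    (a : Finset (Fin r) → N) :
    contract φ i h a = a - (totalD φ (wedge i h a) + wedge i h (totalD φ a)) := rfl

theorem contract_apply (φ : Fin r → Module.End R N) (i : Fin r) (h : Module.End R N)
    (hc : ∀ j, j ≠ i → ∀ z, φ j (h z) = h (φ j z)) (a : Finset (Fin r) → N)
    (T : Finset (Fin r)) :
    contract φ i h a T = if i ∈ T then a T - h (φ i (a T)) else a T - φ i (h (a T)) := by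
  rw [contract_eq, Pi.sub_apply, Pi.add_apply, totalD_wedge_add φ i h hc]
  split_ifs <;> rfl

theorem totalD_contract (φ : Fin r → Module.End R N) (hφ : ∀ i j, Commute (φ i) (φ j))
    (i : Fin r) (h : Module.End R N) (a : Finset (Fin r) → N) :
    totalD φ (contract φ i h a) = contract φ i h (totalD φ a) := by
  rw [contract_eq, contract_eq, map_sub, map_add, totalD_totalD φ hφ, totalD_totalD φ hφ, map_zero]
  simp

end Total

section PowerSeries

variable {R : Type u} [CommRing R] {r : ℕ} {M : Type w} [AddCommGroup M] [Module R M]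

/-! ### The Koszul complex of formal power series -/

variable (R M) in
/-- Multiplication by the variable `U_i` on the module `M[[U]]` of formal power series, given by
their families of coefficients. -/
def mulVar (i : Fin r) : Module.End R ((Fin r → ℕ) → M) where
  toFun f α := if α i = 0 then 0 else f (Function.update α i (α i - 1))
  map_add' f g := by
    ext α
    simp only [Pi.add_apply]
    split_ifs <;> simp
  map_smul' c f := by
    ext α
    simp

theorem mulVar_apply (i : Fin r) (f : (Fin r → ℕ) → M) (α : Fin r → ℕ) :
    mulVar R M i f α = if α i = 0 then 0 else f (Function.update α i (α i - 1)) := rfl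

variable (M) in
/-- Multiplication by `x_i - U_i` on `M[[U]]`. -/
def mulXSubVar (x : Fin r → R) (i : Fin r) : Module.End R ((Fin r → ℕ) → M) :=
  x i • LinearMap.id - mulVar R M i

theorem mulXSubVar_eq (x : Fin r → R) (i : Fin r) (f : (Fin r → ℕ) → M) :
    mulXSubVar M x i f = x i • f - mulVar R M i f := rfl

theorem mulXSubVar_apply (x : Fin r → R) (i : Fin r) (f : (Fin r → ℕ) → M) (α : Fin r → ℕ) :
    mulXSubVar M x i f α =
      x i • f α - if α i = 0 then 0 else f (Function.update α i (α i - 1)) := rfl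

theorem mulVar_comm (i j : Fin r) (f : (Fin r → ℕ) → M) :
    mulVar R M i (mulVar R M j f) = mulVar R M j (mulVar R M i f) := by
  by_cases hij : i = j
  · rw [hij]
  · ext α
    simp only [mulVar_apply, Function.update_of_ne hij, Function.update_of_ne (Ne.symm hij)]
    rw [Function.update_comm hij]
    split_ifs <;> rfl

theorem mulXSubVar_mulVar (x : Fin r → R) (i j : Fin r) (f : (Fin r → ℕ) → M) :
    mulXSubVar M x i (mulVar R M j f) = mulVar R M j (mulXSubVar M x i f) := by
  rw [mulXSubVar_eq, mulXSubVar_eq, map_sub, map_smul, mulVar_comm]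

theorem mulXSubVar_commute (x : Fin r → R) (i j : Fin r) :
    Commute (mulXSubVar M x i) (mulXSubVar M x j) := by
  refine LinearMap.ext fun f => ?_
  change mulXSubVar M x i (mulXSubVar M x j f) = mulXSubVar M x j (mulXSubVar M x i f)
  rw [mulXSubVar_eq x j, mulXSubVar_eq x j, map_sub, map_smul, mulXSubVar_mulVar]

variable (M) in
/-- The differential of the Koszul complex `K_•(x - U; M[[U]])`. -/
abbrev seriesD (x : Fin r → R) :
    (Finset (Fin r) → (Fin r → ℕ) → M) →ₗ[R] (Finset (Fin r) → (Fin r → ℕ) → M) :=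
  totalD (mulXSubVar M x)

theorem seriesD_apply (x : Fin r → R) (a : Finset (Fin r) → (Fin r → ℕ) → M)
    (T : Finset (Fin r)) (α : Fin r → ℕ) :
    seriesD M x a T α = ∑ i ∈ Tᶜ, koszulSign i T • mulXSubVar M x i (a (insert i T)) α := by
  rw [totalD_apply, Finset.sum_apply]
  rfl

variable (M) in
/-- The operator `f ↦ -(f(U_i) - f(x_i)) / (U_i - x_i)` on power series truncated at `U_i ^ n`. -/
def divDiff (x : Fin r → R) (n : ℕ) (i : Fin r) : Module.End R ((Fin r → ℕ) → M) where
  toFun f α := -∑ j ∈ Finset.range (n - 1 - α i), x i ^ j • f (Function.update α i (α i + 1 + j))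
  map_add' f g := by
    ext α
    simp [Finset.sum_add_distrib, add_comm]
  map_smul' c f := by
    ext α
    simp only [Pi.smul_apply, RingHom.id_apply, smul_neg, Finset.smul_sum]
    congr 1
    exact Finset.sum_congr rfl fun i _ => smul_comm _ _ _

theorem divDiff_apply (x : Fin r → R) (n : ℕ) (i : Fin r) (f : (Fin r → ℕ) → M) (α : Fin r → ℕ) :
    divDiff M x n i f α =
      -∑ j ∈ Finset.range (n - 1 - α i), x i ^ j • f (Function.update α i (α i + 1 + j)) := rfl

theorem mulXSubVar_divDiff_comm (x : Fin r → R) (n : ℕ) {i j : Fin r} (hij : j ≠ i)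
    (f : (Fin r → ℕ) → M) :
    mulXSubVar M x j (divDiff M x n i f) = divDiff M x n i (mulXSubVar M x j f) := by
  have h : mulVar R M j (divDiff M x n i f) = divDiff M x n i (mulVar R M j f) := by
    ext α
    simp only [mulVar_apply, divDiff_apply, Function.update_of_ne hij,
      Function.update_of_ne (Ne.symm hij)]
    by_cases h0 : α j = 0
    · simp [h0]
    · simp only [h0, if_false]
      simp only [Function.update_comm hij]
  rw [mulXSubVar_eq, mulXSubVar_eq, map_sub, map_smul, h]

/-- The sum telescopes along the `i`-th exponent from `α i` up to `n - 1`. When `α i ≥ n - 1`,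
truncated subtraction makes it empty and the right side is `f α`. -/
theorem sub_divDiff_mulXSubVar (x : Fin r → R) (n : ℕ) (i : Fin r) (f : (Fin r → ℕ) → M)
    (α : Fin r → ℕ) :
    f α - divDiff M x n i (mulXSubVar M x i f) α =
      x i ^ (n - 1 - α i) • f (Function.update α i (α i + (n - 1 - α i))) := by
  have key : ∀ j, x i ^ j • mulXSubVar M x i f (Function.update α i (α i + 1 + j)) =
      x i ^ (j + 1) • f (Function.update α i (α i + (j + 1))) -
        x i ^ j • f (Function.update α i (α i + j)) := by
    intro j
    rw [mulXSubVar_apply, if_neg (by simp), smul_sub, smul_smul, ← pow_succ]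
    simp only [Function.update_self, Function.update_idem]
    rw [show α i + 1 + j - 1 = α i + j by omega, show α i + 1 + j = α i + (j + 1) by omega]
  rw [divDiff_apply, Finset.sum_congr rfl fun j _ => key j,
    Finset.sum_range_sub (fun j => x i ^ j • f (Function.update α i (α i + j)))]
  simp

/-- The remainder theorem in the variable `U_i`: modulo `U_i ^ n`, division by `U_i - x_i` leaves
the value of the truncated series at `U_i = x_i`. -/
theorem sub_mulXSubVar_divDiff (x : Fin r → R) {n : ℕ} (hn : 0 < n) (i : Fin r)
    (f : (Fin r → ℕ) → M) (α : Fin r → ℕ) :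
    f α - mulXSubVar M x i (divDiff M x n i f) α =
      if α i = 0 then ∑ j ∈ Finset.range n, x i ^ j • f (Function.update α i j)
      else if α i < n then 0 else f α := by
  obtain ⟨n, rfl⟩ : ∃ k, n = k + 1 := ⟨n - 1, by omega⟩
  rw [mulXSubVar_apply]
  by_cases h0 : α i = 0
  · have e : Function.update α i 0 = α := by rw [← h0, Function.update_eq_self]
    simp only [h0, if_true, divDiff_apply, sub_zero, Finset.sum_range_succ', e, pow_zero, one_smul,
      Nat.add_sub_cancel, Nat.sub_zero, zero_add, smul_neg, sub_neg_eq_add, Finset.smul_sum, smul_smul,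
      ← pow_succ']
    rw [add_comm]
    simp only [add_comm]
  · have e : α i - 1 + 1 = α i := by omega
    simp only [h0, if_false, divDiff_apply, Function.update_self, Function.update_idem, e,
      Nat.add_sub_cancel]
    split_ifs with h
    · rw [show n - (α i - 1) = n - α i + 1 by omega, Finset.sum_range_succ']
      simp only [add_zero, Function.update_eq_self, pow_zero, one_smul, smul_neg, Finset.smul_sum,
        smul_smul, ← pow_succ']
      simp only [add_right_comm _ 1, add_assoc]
      abel
    · rw [show n - (α i - 1) = 0 by omega, show n - α i = 0 by omega]
      simp

/-! ### The normal form modulo `U_1 ^ n, …, U_r ^ n` -/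

variable (M) in
/-- The chain endomorphism of `K_•(x - U; M[[U]])` which replaces an element by a normal form in
the `i`-th variable, up to terms divisible by `U_i ^ n`. -/
def normalize (x : Fin r → R) (n : ℕ) (i : Fin r) :
    (Finset (Fin r) → (Fin r → ℕ) → M) →ₗ[R] (Finset (Fin r) → (Fin r → ℕ) → M) :=
  contract (mulXSubVar M x) i (divDiff M x n i)

theorem normalize_eq (x : Fin r → R) (n : ℕ) (i : Fin r) (a : Finset (Fin r) → (Fin r → ℕ) → M) :
    normalize M x n i a = a - (seriesD M x (wedge i (divDiff M x n i) a) +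
      wedge i (divDiff M x n i) (seriesD M x a)) := rfl

theorem normalize_apply_mem (x : Fin r → R) (n : ℕ) {i : Fin r}
    (a : Finset (Fin r) → (Fin r → ℕ) → M) {S : Finset (Fin r)} (hi : i ∈ S) (α : Fin r → ℕ) :
    normalize M x n i a S α =
      x i ^ (n - 1 - α i) • a S (Function.update α i (α i + (n - 1 - α i))) := by
  rw [normalize, contract_apply _ _ _ fun j hj z => mulXSubVar_divDiff_comm x n hj z, if_pos hi,
    Pi.sub_apply, sub_divDiff_mulXSubVar]

theorem normalize_apply_notMem (x : Fin r → R) {n : ℕ} (hn : 0 < n) {i : Fin r}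
    (a : Finset (Fin r) → (Fin r → ℕ) → M) {S : Finset (Fin r)} (hi : i ∉ S) (α : Fin r → ℕ) :
    normalize M x n i a S α =
      if α i = 0 then ∑ j ∈ Finset.range n, x i ^ j • a S (Function.update α i j)
      else if α i < n then 0 else a S α := by
  rw [normalize, contract_apply _ _ _ fun j hj z => mulXSubVar_divDiff_comm x n hj z, if_neg hi,
    Pi.sub_apply, sub_mulXSubVar_divDiff x hn]

theorem seriesD_normalize (x : Fin r → R) (n : ℕ) (i : Fin r)
    (a : Finset (Fin r) → (Fin r → ℕ) → M) :
    seriesD M x (normalize M x n i a) = normalize M x n i (seriesD M x a) :=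
  totalD_contract _ (mulXSubVar_commute x) _ _ _

/-- The power series `f` lies in the submodule generated by `U_1 ^ n, …, U_r ^ n`. -/
def InBox (n : ℕ) (f : (Fin r → ℕ) → M) : Prop :=
  ∀ α : Fin r → ℕ, (∀ i, α i < n) → f α = 0

theorem InBox.mono {m n : ℕ} (h : n ≤ m) {f : (Fin r → ℕ) → M} (hf : InBox m f) : InBox n f :=
  fun α hα => hf α fun i => (hα i).trans_le h

theorem InBox.add {n : ℕ} {f g : (Fin r → ℕ) → M} (hf : InBox n f) (hg : InBox n g) :
    InBox n (f + g) := fun α hα => by rw [Pi.add_apply, hf α hα, hg α hα, add_zero]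

theorem InBox.sub {n : ℕ} {f g : (Fin r → ℕ) → M} (hf : InBox n f) (hg : InBox n g) :
    InBox n (f - g) := fun α hα => by rw [Pi.sub_apply, hf α hα, hg α hα, sub_zero]

theorem InBox.seriesD (x : Fin r → R) {n p : ℕ} {a : Finset (Fin r) → (Fin r → ℕ) → M}
    (ha : ∀ S, S.card = p + 1 → InBox n (a S)) {T : Finset (Fin r)} (hT : T.card = p) :
    InBox n (seriesD M x a T) := by
  intro α hα
  rw [seriesD_apply]
  refine Finset.sum_eq_zero fun i hi => ?_
  have hS := ha (insert i T) (by
    rw [Finset.card_insert_of_notMem (Finset.mem_compl.mp hi), hT])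
  rw [mulXSubVar_apply, hS α hα, hS (Function.update α i (α i - 1)), ite_self, smul_zero, sub_zero,
    smul_zero]
  intro j
  by_cases hj : j = i
  · subst hj
    rw [Function.update_self]
    exact (Nat.sub_le _ _).trans_lt (hα j)
  · rw [Function.update_of_ne hj]
    exact hα j

theorem InBox.normalize (x : Fin r → R) {n : ℕ} (hn : 0 < n) (i : Fin r)
    {a : Finset (Fin r) → (Fin r → ℕ) → M} {S : Finset (Fin r)} (ha : InBox n (a S)) :
    InBox n (normalize M x n i a S) := by
  intro α hα
  have hup : ∀ k < n, a S (Function.update α i k) = 0 := by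
    intro k hk
    refine ha _ fun j => ?_
    by_cases hj : j = i
    · subst hj
      rwa [Function.update_self]
    · rw [Function.update_of_ne hj]
      exact hα j
  by_cases hi : i ∈ S
  · rw [normalize_apply_mem x n a hi, hup _ (by have := hα i; omega), smul_zero]
  · rw [normalize_apply_notMem x hn a hi]
    split_ifs
    · exact Finset.sum_eq_zero fun j hj => by rw [hup j (Finset.mem_range.mp hj), smul_zero]
    · rfl
    · exact ha α hα

theorem InBox.wedge_divDiff (x : Fin r → R) {n : ℕ} (i : Fin r)
    {a : Finset (Fin r) → (Fin r → ℕ) → M} {S : Finset (Fin r)}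
    (ha : i ∈ S → InBox n (a (S.erase i))) :
    InBox n (wedge i (divDiff M x n i) a S) := by
  intro α hα
  rw [wedge_apply]
  split_ifs with hi
  · rw [Pi.smul_apply, divDiff_apply, Finset.sum_eq_zero, neg_zero, smul_zero]
    intro j hj
    rw [Finset.mem_range] at hj
    rw [ha hi _ fun k => ?_, smul_zero]
    by_cases hk : k = i
    · subst hk
      rw [Function.update_self]
      -- The divided difference reads only exponents `α k + 1 + j ≤ n - 1`, so it never leaves the
      -- box.
      omega
    · rw [Function.update_of_ne hk]
      exact hα k
  · rfl

/-- The normal form in the `i`-th variable modulo `U_i ^ n`: on the components indexed by `S` the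
element is constant in `U_i` if `i ∉ S`, and a multiple of `∑ x_i ^ (n - 1 - k) U_i ^ k` if
`i ∈ S`. -/
def IsNormal (x : Fin r → R) (n : ℕ) (i : Fin r) (a : Finset (Fin r) → (Fin r → ℕ) → M) : Prop :=
  ∀ (S : Finset (Fin r)) (α : Fin r → ℕ), α i < n →
    (i ∈ S → a S α = x i ^ (n - 1 - α i) • a S (Function.update α i (n - 1))) ∧
    (i ∉ S → α i ≠ 0 → a S α = 0)

theorem isNormal_normalize (x : Fin r → R) {n : ℕ} (hn : 0 < n) (i : Fin r)
    (a : Finset (Fin r) → (Fin r → ℕ) → M) : IsNormal x n i (normalize M x n i a) := by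
  intro S α hα
  refine ⟨fun hi => ?_, fun hi h0 => ?_⟩
  · rw [normalize_apply_mem x n a hi, normalize_apply_mem x n a hi]
    simp only [Function.update_self, Function.update_idem, Nat.sub_self, pow_zero, one_smul,
      add_zero]
    rw [show α i + (n - 1 - α i) = n - 1 by omega]
  · rw [normalize_apply_notMem x hn a hi, if_neg h0, if_pos hα]

/-- Normalizing in `U_i` combines only coefficients that differ in the `i`-th exponent, so the
linear conditions in another variable survive. This allows the variables to be treated one after
another. -/
theorem IsNormal.normalize (x : Fin r → R) {n : ℕ} (hn : 0 < n) (i : Fin r) {j : Fin r}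
    {a : Finset (Fin r) → (Fin r → ℕ) → M} (ha : IsNormal x n j a) :
    IsNormal x n j (normalize M x n i a) := by
  by_cases hij : j = i
  · subst hij
    exact isNormal_normalize x hn j a
  intro S α hα
  have hα' : ∀ k, Function.update α i k j < n := fun k => by rwa [Function.update_of_ne hij]
  refine ⟨fun hj => ?_, fun hj h0 => ?_⟩
  · have key : ∀ k, a S (Function.update α i k) = x j ^ (n - 1 - α j) •
        a S (Function.update (Function.update α j (n - 1)) i k) := by
      intro k
      rw [(ha S _ (hα' k)).1 hj, Function.update_of_ne hij, Function.update_comm hij]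
    have key' := (ha S α hα).1 hj
    by_cases hi : i ∈ S
    · rw [normalize_apply_mem x n a hi, normalize_apply_mem x n a hi, key,
        Function.update_of_ne (Ne.symm hij), smul_comm]
    · rw [normalize_apply_notMem x hn a hi, normalize_apply_notMem x hn a hi,
        Function.update_of_ne (Ne.symm hij)]
      split_ifs
      · rw [Finset.smul_sum]
        exact Finset.sum_congr rfl fun k _ => by rw [key, smul_comm]
      · rw [smul_zero]
      · exact key'
  · have key : ∀ k, a S (Function.update α i k) = 0 := by
      intro k
      exact (ha S _ (hα' k)).2 hj (by rwa [Function.update_of_ne hij])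
    have key' := (ha S α hα).2 hj h0
    by_cases hi : i ∈ S
    · rw [normalize_apply_mem x n a hi, key, smul_zero]
    · rw [normalize_apply_notMem x hn a hi]
      split_ifs
      · exact Finset.sum_eq_zero fun k _ => by rw [key, smul_zero]
      · rfl
      · exact key'

theorem IsNormal.normalize_eq_self (x : Fin r → R) {n : ℕ} (hn : 0 < n) {i : Fin r}
    {a : Finset (Fin r) → (Fin r → ℕ) → M} (ha : IsNormal x n i a) :
    WeakProreg.normalize M x n i a = a := by
  funext S α
  by_cases hi : i ∈ S
  · rw [normalize_apply_mem x n a hi]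
    by_cases h : α i < n
    · rw [show α i + (n - 1 - α i) = n - 1 by omega]
      exact ((ha S α h).1 hi).symm
    · rw [show n - 1 - α i = 0 by omega]
      simp
  · rw [normalize_apply_notMem x hn a hi]
    split_ifs with h0 h1
    · rw [Finset.sum_eq_single_of_mem 0 (Finset.mem_range.mpr hn)]
      · rw [← h0, Function.update_eq_self, h0, pow_zero, one_smul]
      · intro j hj hj0
        rw [(ha S _ (by simpa using hj)).2 hi (by simpa using hj0), smul_zero]
    · exact ((ha S α h1).2 hi h0).symm
    · rfl

/-- An element whose boundary is divisible by `U_1 ^ n, …, U_r ^ n` is homologous to one in normal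
form. -/
theorem exists_isNormal (x : Fin r → R) {n p : ℕ} (hn : 0 < n)
    (a : Finset (Fin r) → (Fin r → ℕ) → M)
    (ha : ∀ T : Finset (Fin r), T.card + 1 = p → InBox n (seriesD M x a T)) :
    ∃ a' b, (∀ i, IsNormal x n i a') ∧
      (∀ T : Finset (Fin r), T.card + 1 = p → InBox n (seriesD M x a' T)) ∧
      ∀ S : Finset (Fin r), S.card = p → InBox n ((a - a' - seriesD M x b) S) := by
  suffices h : ∀ s : Finset (Fin r), ∃ a' b, (∀ i ∈ s, IsNormal x n i a') ∧
      (∀ T : Finset (Fin r), T.card + 1 = p → InBox n (seriesD M x a' T)) ∧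
      ∀ S : Finset (Fin r), S.card = p → InBox n ((a - a' - seriesD M x b) S) by
    obtain ⟨a', b, h1, h2⟩ := h Finset.univ
    exact ⟨a', b, fun i => h1 i (Finset.mem_univ i), h2⟩
  intro s
  induction s using Finset.induction_on with
  | empty => exact ⟨a, 0, by simp, ha, fun S _ α _ => by simp⟩
  | insert i s _ ih =>
    obtain ⟨a', b, h1, h2, h3⟩ := ih
    refine ⟨normalize M x n i a', b + wedge i (divDiff M x n i) a', ?_, ?_, ?_⟩
    · intro j hj
      rcases Finset.mem_insert.mp hj with rfl | hj
      · exact isNormal_normalize x hn j a'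
      · exact (h1 j hj).normalize x hn i
    · intro T hT
      rw [seriesD_normalize]
      exact (h2 T hT).normalize x hn i
    · intro S hS
      -- The homotopy formula leaves the error `h d a'`, which is negligible because `d a'` already
      -- vanishes on the box.
      have e : a - normalize M x n i a' - seriesD M x (b + wedge i (divDiff M x n i) a') =
          (a - a' - seriesD M x b) + wedge i (divDiff M x n i) (seriesD M x a') := by
        rw [normalize_eq, map_add]
        abel
      rw [e]
      refine (h3 S hS).add (InBox.wedge_divDiff x i fun hi => h2 _ ?_)
      rw [Finset.card_erase_of_mem hi, hS, Nat.sub_add_cancel]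
      rw [← hS]
      exact Finset.card_pos.mpr ⟨i, hi⟩

/-- If an element in normal form is a boundary modulo `U_1 ^ n, …, U_r ^ n`, then it is the
boundary of an element in normal form. -/
theorem exists_isNormal_boundary (x : Fin r → R) {n p : ℕ} (hn : 0 < n)
    {a b : Finset (Fin r) → (Fin r → ℕ) → M} (ha : ∀ i, IsNormal x n i a)
    (hb : ∀ S : Finset (Fin r), S.card = p → InBox n ((a - seriesD M x b) S)) :
    ∃ b', (∀ i, IsNormal x n i b') ∧
      ∀ S : Finset (Fin r), S.card = p → InBox n ((a - seriesD M x b') S) := by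
  suffices h : ∀ s : Finset (Fin r), ∃ b', (∀ i ∈ s, IsNormal x n i b') ∧
      ∀ S : Finset (Fin r), S.card = p → InBox n ((a - seriesD M x b') S) by
    obtain ⟨b', h1, h2⟩ := h Finset.univ
    exact ⟨b', fun i => h1 i (Finset.mem_univ i), h2⟩
  intro s
  induction s using Finset.induction_on with
  | empty => exact ⟨b, by simp, hb⟩
  | insert i s _ ih =>
    obtain ⟨b', h1, h2⟩ := ih
    refine ⟨normalize M x n i b', ?_, ?_⟩
    · intro j hj
      rcases Finset.mem_insert.mp hj with rfl | hj
      · exact isNormal_normalize x hn j b'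
      · exact (h1 j hj).normalize x hn i
    · intro S hS
      have e : a - seriesD M x (normalize M x n i b') =
          normalize M x n i (a - seriesD M x b') := by
        rw [map_sub, (ha i).normalize_eq_self x hn, seriesD_normalize]
      rw [e]
      exact (h2 S hS).normalize x hn i

end PowerSeries

section Comparison

variable {R : Type u} [CommRing R] {r : ℕ} {M : Type w} [AddCommGroup M] [Module R M]

/-! ### Comparison with the Koszul complexes of the powers -/

variable (M) in
/-- The differential of the Koszul complex `K_•(x^(n); M)`. -/
abbrev powD (x : Fin r → R) (n : ℕ) : (Finset (Fin r) → M) →ₗ[R] (Finset (Fin r) → M) :=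
  totalD fun i => x i ^ n • LinearMap.id

theorem powD_apply (x : Fin r → R) (n : ℕ) (c : Finset (Fin r) → M) (T : Finset (Fin r)) :
    powD M x n c T = ∑ i ∈ Tᶜ, koszulSign i T • x i ^ n • c (insert i T) := rfl

theorem powD_prod_smul (x : Fin r → R) (n k : ℕ) (c : Finset (Fin r) → M) (T : Finset (Fin r)) :
    powD M x n (fun S => (∏ i ∈ S, x i ^ k) • c S) T =
      (∏ i ∈ T, x i ^ k) • powD M x (n + k) c T := by
  rw [powD_apply, powD_apply, Finset.smul_sum]
  refine Finset.sum_congr rfl fun i hi => ?_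
  rw [Finset.prod_insert (Finset.mem_compl.mp hi), smul_comm (∏ i ∈ T, x i ^ k), smul_smul,
    smul_smul, ← mul_assoc, ← pow_add, mul_comm (∏ i ∈ T, x i ^ k)]

/-- The inverse system of the Koszul homology modules `H_{p+1}(x^(n); M)` is pro-zero. -/
def KoszulProZero (x : Fin r → R) (M : Type w) [AddCommGroup M] [Module R M] (p : ℕ) : Prop :=
  ∀ n : ℕ, ∃ m, n ≤ m ∧ ∀ c : Finset (Fin r) → M,
    (∀ T : Finset (Fin r), T.card = p → powD M x m c T = 0) →
    ∃ e, ∀ S : Finset (Fin r), S.card = p + 1 →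
      (∏ i ∈ S, x i ^ (m - n)) • c S = powD M x n e S

/-- The inverse system of the homology modules in degree `p + 1` of the Koszul complexes
`K_•(x - U; M[[U]] / (U_1 ^ n, …, U_r ^ n))` is pro-zero. -/
def SeriesProZero (x : Fin r → R) (M : Type w) [AddCommGroup M] [Module R M] (p : ℕ) : Prop :=
  ∀ n : ℕ, ∃ m, n ≤ m ∧ ∀ a : Finset (Fin r) → (Fin r → ℕ) → M,
    (∀ T : Finset (Fin r), T.card = p → InBox m (seriesD M x a T)) →
    ∃ b, ∀ S : Finset (Fin r), S.card = p + 1 → InBox n ((a - seriesD M x b) S)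

/-- The exponent which is `n - 1` on `S` and zero elsewhere. -/
def corner (n : ℕ) (S : Finset (Fin r)) : Fin r → ℕ := fun i => if i ∈ S then n - 1 else 0

theorem corner_lt {n : ℕ} (hn : 0 < n) (S : Finset (Fin r)) (i : Fin r) : corner n S i < n := by
  unfold corner
  split_ifs <;> omega

/-- The map `K_•(x^(n); M) → K_•(x - U; M[[U]])` in normal form, which sends `e_S ⊗ m` to
`e_S ⊗ ∏_{i ∈ S} (∑_k x_i ^ (n - 1 - k) U_i ^ k) m`; it commutes with the differentials modulo
`U_1 ^ n, …, U_r ^ n`. -/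
def normalForm (x : Fin r → R) (n : ℕ) (c : Finset (Fin r) → M) :
    Finset (Fin r) → (Fin r → ℕ) → M :=
  fun S α => if ∀ i, i ∉ S → α i = 0 then (∏ i ∈ S, x i ^ (n - 1 - α i)) • c S else 0

theorem normalForm_corner (x : Fin r → R) (n : ℕ) (c : Finset (Fin r) → M)
    (S : Finset (Fin r)) : normalForm x n c S (corner n S) = c S := by
  rw [normalForm, if_pos (show ∀ i, i ∉ S → corner n S i = 0 from fun i hi => if_neg hi), Finset.prod_eq_one, one_smul]
  intro i hi
  rw [corner, if_pos hi, Nat.sub_self, pow_zero]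

theorem isNormal_normalForm (x : Fin r → R) (n : ℕ) (c : Finset (Fin r) → M) (i : Fin r) :
    IsNormal x n i (normalForm x n c) := by
  intro S α hα
  refine ⟨fun hi => ?_, fun hi h0 => if_neg fun h => h0 (h i hi)⟩
  have hiff : (∀ j, j ∉ S → Function.update α i (n - 1) j = 0) ↔ ∀ j, j ∉ S → α j = 0 := by
    refine forall_congr' fun j => imp_congr_right fun hj => ?_
    rw [Function.update_of_ne fun e : j = i => hj (e ▸ hi)]
  simp only [normalForm, hiff]
  split_ifs
  · rw [← Finset.mul_prod_erase S _ hi, ← Finset.mul_prod_erase S _ hi, Function.update_self,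
      Nat.sub_self, pow_zero, one_mul, mul_smul]
    congr 2
    refine Finset.prod_congr rfl fun j hj => ?_
    rw [Function.update_of_ne (Finset.ne_of_mem_erase hj)]
  · rw [smul_zero]

/-- Below the truncation, a normal element is determined by its corner coefficients: the exponents
in `S` are raised to `n - 1` one at a time, each at the cost of a power of `x_i`. -/
theorem normalForm_of_isNormal (x : Fin r → R) {n : ℕ} {a : Finset (Fin r) → (Fin r → ℕ) → M}
    (ha : ∀ i, IsNormal x n i a) (S : Finset (Fin r)) :
    InBox n ((a - normalForm x n fun S => a S (corner n S)) S) := by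
  intro α hα
  rw [Pi.sub_apply, Pi.sub_apply, sub_eq_zero]
  rw [normalForm]
  split_ifs with h
  · have key : ∀ s ⊆ S, a S α =
        (∏ i ∈ s, x i ^ (n - 1 - α i)) • a S (fun i => if i ∈ s then n - 1 else α i) := by
      intro s
      induction s using Finset.induction_on with
      | empty => simp
      | insert i s hi ih =>
        intro hs
        rw [ih fun j hj => hs (Finset.mem_insert_of_mem hj), Finset.prod_insert hi, mul_comm,
          mul_smul, ((ha i) S _ _).1 (hs (Finset.mem_insert_self i s)), if_neg hi]
        · congr 3
          funext j
          by_cases hj : j = i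
          · subst hj
            simp
          · simp [hj]
        · rw [if_neg hi]
          exact hα i
    rw [key S subset_rfl]
    congr 2
    funext i
    simp only [corner]
    split_ifs with hi
    · rfl
    · exact h i hi
  · push Not at h
    obtain ⟨i, hi, h0⟩ := h
    exact (ha i S α (hα i)).2 hi h0

/-- Taking corner coefficients is a chain map to `K(x^(n); M)` on normal elements. At exponent `0`
in `U_i` the factor `x_i - U_i` acts as `x_i`, and passing to exponent `n - 1` contributes the
remaining `x_i ^ (n - 1)`. -/
theorem seriesD_corner (x : Fin r → R) {n : ℕ} (hn : 0 < n)
    {a : Finset (Fin r) → (Fin r → ℕ) → M} (ha : ∀ i, IsNormal x n i a) (T : Finset (Fin r)) :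
    seriesD M x a T (corner n T) = powD M x n (fun S => a S (corner n S)) T := by
  rw [seriesD_apply, powD_apply]
  refine Finset.sum_congr rfl fun i hi => ?_
  have hi : i ∉ T := Finset.mem_compl.mp hi
  have h0 : corner n T i = 0 := if_neg hi
  have hu : Function.update (corner n T) i (n - 1) = corner n (insert i T) := by
    funext j
    by_cases hj : j = i
    · subst hj
      simp [corner]
    · simp [corner, hj]
  rw [mulXSubVar_apply, if_pos h0, sub_zero,
    (ha i _ _ (corner_lt hn T i)).1 (Finset.mem_insert_self i T), hu, h0, Nat.sub_zero, smul_smul,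
    ← pow_succ', Nat.sub_add_cancel hn]

/-- Since `normalize` commutes with the differential, boundaries of normal elements are normal, and
it suffices to compare corner coefficients. -/
theorem seriesD_normalForm (x : Fin r → R) {n : ℕ} (hn : 0 < n) (c : Finset (Fin r) → M)
    (T : Finset (Fin r)) :
    InBox n ((seriesD M x (normalForm x n c) - normalForm x n (powD M x n c)) T) := by
  have hc := isNormal_normalForm x n c
  have h : ∀ i, IsNormal x n i (seriesD M x (normalForm x n c)) := by
    intro i
    rw [← (hc i).normalize_eq_self x hn, seriesD_normalize]
    exact isNormal_normalize x hn i _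
  have := normalForm_of_isNormal x h T
  simpa only [seriesD_corner x hn hc, normalForm_corner] using this

/-- Truncation from `m` to `n` induces the natural map of Koszul complexes, since `m - 1 - k = (m -
n) + (n - 1 - k)` for `k < n`. -/
theorem normalForm_transition (x : Fin r → R) {n m : ℕ} (hnm : n ≤ m) (c : Finset (Fin r) → M)
    (S : Finset (Fin r)) :
    InBox n ((normalForm x m c -
      normalForm x n fun S => (∏ i ∈ S, x i ^ (m - n)) • c S) S) := by
  intro α hα
  rw [Pi.sub_apply, Pi.sub_apply, sub_eq_zero, normalForm, normalForm]
  congr 1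
  rw [smul_smul, ← Finset.prod_mul_distrib]
  congr 1
  refine Finset.prod_congr rfl fun i _ => ?_
  rw [← pow_add]
  congr 1
  have := hα i
  omega

theorem KoszulProZero.seriesProZero {x : Fin r → R} {p : ℕ} (h : KoszulProZero x M p) :
    SeriesProZero x M p := by
  intro n
  -- Normal forms need a positive truncation order; `n + 1` covers the case `n = 0`.
  obtain ⟨m, hm, H⟩ := h (n + 1)
  refine ⟨m, by omega, fun a ha => ?_⟩
  obtain ⟨a', b, h1, h2, h3⟩ := exists_isNormal x (p := p + 1) (by omega) a
    (fun T hT => ha T (by omega))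
  obtain ⟨e, he⟩ := H (fun S => a' S (corner m S)) fun T hT => by
    rw [← seriesD_corner x (by omega) h1]
    exact h2 T (by omega) _ (corner_lt (by omega) T)
  refine ⟨b + normalForm x (n + 1) e, fun S hS => InBox.mono (Nat.le_succ n) ?_⟩
  have h4 := normalForm_transition x hm (fun S => a' S (corner m S)) S
  have h5 := seriesD_normalForm x (Nat.succ_pos n) e S
  have h6 := (h3 S hS).mono hm
  have h7 := (normalForm_of_isNormal x h1 S).mono hm
  have h8 : normalForm x (n + 1) (powD M x (n + 1) e) S = normalForm x (n + 1)
      (fun S => (∏ i ∈ S, x i ^ (m - (n + 1))) • a' S (corner m S)) S := by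
    funext α
    simp only [normalForm, he S hS]
  have e : (a - seriesD M x (b + normalForm x (n + 1) e)) S =
      ((a - a' - seriesD M x b) S + (a' - normalForm x m fun S => a' S (corner m S)) S) +
      ((normalForm x m (fun S => a' S (corner m S)) - normalForm x (n + 1)
        fun S => (∏ i ∈ S, x i ^ (m - (n + 1))) • a' S (corner m S)) S -
      (seriesD M x (normalForm x (n + 1) e) - normalForm x (n + 1) (powD M x (n + 1) e)) S) := by
    simp only [map_add, Pi.sub_apply, Pi.add_apply, h8]
    abel
  rw [e]
  exact (h6.add h7).add (h4.sub h5)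

theorem SeriesProZero.koszulProZero {x : Fin r → R} {p : ℕ} (h : SeriesProZero x M p) :
    KoszulProZero x M p := by
  intro n
  obtain ⟨m, hm, H⟩ := h (n + 1)
  refine ⟨m, by omega, fun c hc => ?_⟩
  obtain ⟨b, hb⟩ := H (normalForm x m c) fun T hT => by
    have := seriesD_normalForm x (n := m) (by omega) c T
    rwa [Pi.sub_apply, show normalForm x m (powD M x m c) T = 0 by
      funext α
      simp [normalForm, hc T hT], sub_zero] at this
  obtain ⟨b', h1, h2⟩ := exists_isNormal_boundary x (p := p + 1) (Nat.succ_pos n) (b := b)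
    (isNormal_normalForm x (n + 1) fun S => (∏ i ∈ S, x i ^ (m - (n + 1))) • c S)
    fun S hS => by
      have := (hb S hS).sub (normalForm_transition x hm c S)
      rwa [← Pi.sub_apply, sub_sub_sub_cancel_left] at this
  -- The primitive is found at level `n + 1`; one more transition map brings it down to level `n`.
  refine ⟨fun S => (∏ i ∈ S, x i ^ 1) • b' S (corner (n + 1) S), fun S hS => ?_⟩
  rw [powD_prod_smul, ← seriesD_corner x (Nat.succ_pos n) h1]
  have := h2 S hS _ (corner_lt (Nat.succ_pos n) S)
  rw [Pi.sub_apply, Pi.sub_apply, sub_eq_zero, normalForm_corner] at this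
  rw [← this, smul_smul, ← Finset.prod_mul_distrib]
  congr 1
  refine Finset.prod_congr rfl fun i _ => ?_
  rw [← pow_add]
  congr 1
  omega

/-- The index `m` obtained over `R` serves all coordinates simultaneously, and a family indexed by
finitely many sets involves only finitely many basis vectors. -/
theorem KoszulProZero.of_free [Module.Free R M] {x : Fin r → R} {p : ℕ}
    (h : KoszulProZero x R p) : KoszulProZero x M p := by
  classical
  intro n
  obtain ⟨m, hm, H⟩ := h n
  refine ⟨m, hm, fun c hc => ?_⟩
  let v := Module.Free.chooseBasis R M
  have hcoord : ∀ j, ∀ T : Finset (Fin r), T.card = p →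
      powD R x m (fun S => v.repr (c S) j) T = 0 := by
    intro j T hT
    have := congrArg (fun z => v.repr z j) (hc T hT)
    simpa [powD_apply, Finsupp.finsetSum_apply] using this
  choose e he using fun j => H _ (hcoord j)
  let J := Finset.univ.biUnion fun S => (v.repr (c S)).support
  have hJ : ∀ S, c S = ∑ j ∈ J, v.repr (c S) j • v j := by
    intro S
    conv_lhs => rw [← v.linearCombination_repr (c S), Finsupp.linearCombination_apply]
    exact Finsupp.sum_of_support_subset _
      (Finset.subset_biUnion_of_mem (fun S => (v.repr (c S)).support) (Finset.mem_univ S)) _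
      (by simp)
  refine ⟨fun S => ∑ j ∈ J, e j S • v j, fun S hS => ?_⟩
  rw [hJ S, Finset.smul_sum, powD_apply]
  simp only [Finset.smul_sum]
  rw [Finset.sum_comm]
  refine Finset.sum_congr rfl fun j _ => ?_
  rw [smul_smul, ← smul_eq_mul, he j S hS, powD_apply, Finset.sum_smul]
  exact Finset.sum_congr rfl fun i _ => by rw [smul_assoc, smul_assoc]

end Comparison

section Limit

variable {R : Type u} [CommRing R] {r : ℕ} {M : Type w} [AddCommGroup M] [Module R M]

/-! ### Passage to the limit -/

theorem lt_sum_add_one (α : Fin r → ℕ) (i : Fin r) : α i < ∑ j, α j + 1 :=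
  Nat.lt_succ_of_le (Finset.single_le_sum (fun _ _ => Nat.zero_le _) (Finset.mem_univ i))

theorem seriesD_map {M' : Type*} [AddCommGroup M'] [Module R M'] (f : M →ₗ[R] M') (x : Fin r → R)
    (a : Finset (Fin r) → (Fin r → ℕ) → M) (T : Finset (Fin r)) (α : Fin r → ℕ) :
    seriesD M' x (fun S β => f (a S β)) T α = f (seriesD M x a T α) := by
  rw [seriesD_apply, seriesD_apply, map_sum]
  refine Finset.sum_congr rfl fun i _ => ?_
  rw [mulXSubVar_apply, mulXSubVar_apply, map_zsmul, map_sub, map_smul]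
  split_ifs <;> simp

/-- If the homology in degree `p + 1` is pro-zero modulo the powers of the variables, then an
element of degree `p` which is a boundary modulo all of these powers is a boundary. -/
theorem SeriesProZero.exists_seriesD_eq {x : Fin r → R} {p : ℕ} (h : SeriesProZero x M p)
    (a : Finset (Fin r) → (Fin r → ℕ) → M)
    (ha : ∀ n, ∃ b, ∀ S : Finset (Fin r), S.card = p → InBox n ((a - seriesD M x b) S)) :
    ∃ b, ∀ S : Finset (Fin r), S.card = p → a S = seriesD M x b S := by
  choose m hm H using h
  choose b hb using ha
  -- A cofinal sequence of truncation orders, chosen so that cycles modulo level `ν (k + 1)` become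
  -- boundaries modulo level `ν k`.
  let ν : ℕ → ℕ := fun k => Nat.rec 0 (fun _ l => max (m l) (l + 1)) k
  have hν : ∀ k, ν (k + 1) = max (m (ν k)) (ν k + 1) := fun k => rfl
  have hνm : ∀ k, m (ν k) ≤ ν (k + 1) := fun k => by rw [hν]; exact le_max_left _ _
  have hνs : StrictMono ν := strictMono_nat_of_lt_succ fun k => by
    rw [hν]; exact lt_of_lt_of_le (Nat.lt_succ_self _) (le_max_right _ _)
  -- The difference of two approximate primitives is an approximate cycle, hence a boundary modulo
  -- level `ν k`. Subtracting that boundary from the finer primitive makes it agree with the coarser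
  -- one there, without changing its differential.
  have step : ∀ k c,
      (∀ S : Finset (Fin r), S.card = p → InBox (ν (k + 1)) ((a - seriesD M x c) S)) →
      ∃ c', (∀ S : Finset (Fin r), S.card = p →
          InBox (ν (k + 1 + 1)) ((a - seriesD M x c') S)) ∧
        ∀ S : Finset (Fin r), S.card = p + 1 → InBox (ν k) ((c' - c) S) := by
    intro k c hc
    obtain ⟨e, he⟩ := H (ν k) (b (ν (k + 1 + 1)) - c) fun T hT => by
      have h1 := (hb (ν (k + 1 + 1)) T hT).mono (hνs.monotone (Nat.le_succ (k + 1)))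
      have h2 := (hc T hT).sub h1
      rw [← Pi.sub_apply, sub_sub_sub_cancel_left, ← map_sub] at h2
      exact h2.mono (hνm k)
    refine ⟨b (ν (k + 1 + 1)) - seriesD M x e, fun S hS => ?_, fun S hS => ?_⟩
    · rw [map_sub, totalD_totalD _ (mulXSubVar_commute x), sub_zero]
      exact hb _ S hS
    · rw [sub_right_comm]
      exact he S hS
  choose! next hnext1 hnext2 using step
  let c : ℕ → Finset (Fin r) → (Fin r → ℕ) → M := fun k => Nat.rec (b (ν 1)) next k
  have hc1 : ∀ k, ∀ S : Finset (Fin r), S.card = p →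
      InBox (ν (k + 1)) ((a - seriesD M x (c k)) S) := by
    intro k
    induction k with
    | zero => exact hb _
    | succ k ih => exact hnext1 k (c k) ih
  have hc2 : ∀ k, ∀ S : Finset (Fin r), S.card = p + 1 → InBox (ν k) ((c (k + 1) - c k) S) :=
    fun k => hnext2 k (c k) (hc1 k)
  have hstab : ∀ k l, k ≤ l → ∀ S : Finset (Fin r), S.card = p + 1 →
      ∀ α : Fin r → ℕ, (∀ i, α i < ν k) → c l S α = c k S α := by
    intro k l hkl S hS α hα
    induction l, hkl using Nat.le_induction with
    | base => rfl
    | succ l hl ih =>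
      rw [← ih, ← sub_eq_zero]
      exact hc2 l S hS α fun i => (hα i).trans_le (hνs.monotone hl)
  have hlim : ∀ k, ∀ S : Finset (Fin r), S.card = p + 1 →
      InBox (ν k) ((c k - fun S α => c (∑ i, α i + 1) S α) S) := by
    intro k S hS α hα
    rw [Pi.sub_apply, Pi.sub_apply, sub_eq_zero]
    rcases le_total k (∑ i, α i + 1) with hk | hk
    · exact (hstab _ _ hk S hS α hα).symm
    · exact hstab _ _ hk S hS α fun i => (lt_sum_add_one α i).trans_le hνs.le_apply
  -- The limit primitive: the coefficient at `α` is already stable at stage `∑ i, α i + 1`, because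
  -- `α i < ∑ j, α j + 1 ≤ ν (∑ j, α j + 1)`.
  refine ⟨fun S α => c (∑ i, α i + 1) S α, fun S hS => funext fun α => ?_⟩
  have h1 := (hc1 (∑ i, α i + 1) S hS).mono (hνs.monotone (Nat.le_succ (∑ i, α i + 1)))
  have h2 := InBox.seriesD x (hlim (∑ i, α i + 1)) hS
  have h3 := h1.add h2
  rw [map_sub, ← Pi.add_apply, sub_add_sub_cancel] at h3
  exact sub_eq_zero.mp (h3 α fun i => (lt_sum_add_one α i).trans_le hνs.le_apply)

/-- If `M` is free of countably infinite rank, the homology of `K_•(x - U; M[[U]])` vanishes in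
degree `p + 1`, and the cycles of degree `p` which are boundaries modulo all powers of the variables
are boundaries, then the homology in degree `p + 1` is pro-zero modulo the powers of the
variables. -/
theorem seriesProZero_of_limit {x : Fin r → R} {p : ℕ} (e : M ≃ₗ[R] (ℕ →₀ R))
    (h1 : ∀ a : Finset (Fin r) → (Fin r → ℕ) → M,
      (∀ T : Finset (Fin r), T.card = p → seriesD M x a T = 0) →
      ∃ b, ∀ S : Finset (Fin r), S.card = p + 1 → a S = seriesD M x b S)
    (h0 : ∀ a : Finset (Fin r) → (Fin r → ℕ) → M,
      (∀ T : Finset (Fin r), T.card + 1 = p → seriesD M x a T = 0) →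
      (∀ n, ∃ b, ∀ S : Finset (Fin r), S.card = p → InBox n ((a - seriesD M x b) S)) →
      ∃ b, ∀ S : Finset (Fin r), S.card = p → a S = seriesD M x b S) :
    SeriesProZero x R p := by
  classical
  by_contra hcon
  unfold SeriesProZero at hcon
  push Not at hcon
  obtain ⟨n, hn⟩ := hcon
  -- `a k` is a cycle modulo level `max k n` but not a boundary modulo level `n`, with `n`
  -- independent of `k`.
  choose a ha ha' using fun k => hn (max k n) (le_max_right k n)
  let κ : ℕ → M →ₗ[R] R := fun k => Finsupp.lapply k ∘ₗ e.toLinearMap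
  let ι : ℕ → R →ₗ[R] M := fun k => e.symm.toLinearMap ∘ₗ Finsupp.lsingle k
  have hκι : ∀ j k c, κ j (ι k c) = if k = j then c else 0 := by
    intro j k c
    simp [κ, ι, Finsupp.single_apply]
  have hκ : ∀ y : M, (∀ j, κ j y = 0) → y = 0 := fun y hy => by
    refine e.injective (Finsupp.ext fun j => ?_)
    rw [map_zero]
    exact hy j
  -- This is `∑ ι k (d (a k))`. Each coefficient involves finitely many `k`, since `d (a k)`
  -- vanishes on the box of size `k`; the family `∑ ι k (a k)` itself need not have coefficients in
  -- `M`.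
  let z : Finset (Fin r) → (Fin r → ℕ) → M := fun T α =>
    ∑ k ∈ Finset.range (∑ i, α i + 1), ι k (seriesD R x (a k) T α)
  have hz : ∀ j, ∀ T : Finset (Fin r), T.card = p → ∀ α,
      κ j (z T α) = seriesD R x (a j) T α := by
    intro j T hT α
    simp only [z, map_sum, hκι, Finset.sum_ite_eq', Finset.mem_range]
    split_ifs with h
    · rfl
    · refine (ha j T hT α fun i => lt_max_of_lt_left ?_).symm
      exact (lt_sum_add_one α i).trans_le (not_lt.mp h)
  obtain ⟨b, hb⟩ := h0 z (by
    intro T hT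
    refine funext fun α => hκ _ fun j => ?_
    rw [← seriesD_map]
    refine Eq.trans ?_ (congrFun (congrFun (totalD_totalD _ (mulXSubVar_commute x) (a j)) T) α)
    refine congrFun (totalD_congr _ (p := T.card) (fun S hS => funext fun β => ?_) rfl) α
    exact hz j S (hS.trans hT) β) (by
    intro l
    -- The first `l` terms give a primitive modulo level `l`, as all later boundaries vanish on that
    -- box.
    refine ⟨fun S α => ∑ k ∈ Finset.range l, ι k (a k S α), fun S hS α hα => hκ _ fun j => ?_⟩
    rw [Pi.sub_apply, Pi.sub_apply, map_sub, hz j S hS, ← seriesD_map]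
    simp only [map_sum, hκι, Finset.sum_ite_eq', Finset.mem_range]
    split_ifs with h
    · exact sub_self _
    · rw [ha j S hS α fun i => lt_max_of_lt_left ((hα i).trans_le (not_lt.mp h)), zero_sub,
        neg_eq_zero]
      exact congrFun (congrFun (map_zero (seriesD R x)) S) α)
  -- The coordinates met by the finitely many coefficients of `b` in the box of size `n`; outside
  -- `J`, the coordinates of `b` vanish modulo level `n`.
  let J : Finset ℕ := Finset.univ.biUnion fun S : Finset (Fin r) =>
    (Fintype.piFinset fun _ : Fin r => Finset.range n).biUnion fun α => (e (b S α)).support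
  obtain ⟨k, hk⟩ := Infinite.exists_notMem_finset J
  have hkb : ∀ S, InBox n fun α => κ k (b S α) := by
    intro S α hα
    by_contra hne
    refine hk (Finset.mem_biUnion.mpr ⟨S, Finset.mem_univ S, Finset.mem_biUnion.mpr ⟨α, ?_, ?_⟩⟩)
    · exact Fintype.mem_piFinset.mpr fun i => Finset.mem_range.mpr (hα i)
    · exact Finsupp.mem_support_iff.mpr hne
  -- The `k`-th coordinate of `b` and `a k` have the same boundary. Their difference is a cycle over
  -- `R`, moved into `M` through coordinate `0` so that acyclicity applies.
  obtain ⟨b', hb'⟩ := h1 (fun S α => ι 0 (κ k (b S α) - a k S α)) (by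
    intro T hT
    funext α
    rw [seriesD_map (ι 0) x (fun S α => κ k (b S α) - a k S α)]
    have : seriesD R x (fun S α => κ k (b S α) - a k S α) T α =
        seriesD R x (fun S α => κ k (b S α)) T α - seriesD R x (a k) T α :=
      congrFun (congrFun (map_sub (seriesD R x) (fun S α => κ k (b S α)) (a k)) T) α
    rw [this, seriesD_map, ← hb T hT, hz k T hT, sub_self, map_zero]
    rfl)
  obtain ⟨S, hS, hS'⟩ := ha' k (-fun S α => κ 0 (b' S α))
  refine hS' fun α hα => ?_
  have h2 := congrArg (κ 0) (congrFun (hb' S hS) α)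
  rw [hκι, if_pos rfl, show κ k (b S α) = 0 from hkb S α hα, zero_sub, ← seriesD_map] at h2
  rw [map_neg, Pi.sub_apply, Pi.sub_apply, Pi.neg_apply, Pi.neg_apply, ← h2, neg_neg, sub_self]

end Limit

section DegreeZero

variable {R : Type u} [CommRing R] {r : ℕ} {M : Type w} [AddCommGroup M] [Module R M]

/-! ### Homology in degree zero and the completion -/

variable (M) in
/-- The submodule `(x - U) M[[U]]` of `M[[U]]`. -/
def boundaries (x : Fin r → R) : Submodule R ((Fin r → ℕ) → M) :=
  ⨆ i, LinearMap.range (mulXSubVar M x i)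

theorem mulXSubVar_mem_boundaries (x : Fin r → R) (i : Fin r) (f : (Fin r → ℕ) → M) :
    mulXSubVar M x i f ∈ boundaries M x :=
  Submodule.mem_iSup_of_mem i ⟨f, rfl⟩

theorem mem_boundaries_iff (x : Fin r → R) (f : (Fin r → ℕ) → M) :
    f ∈ boundaries M x ↔ ∃ b, f = seriesD M x b ∅ := by
  have hs : ∀ i : Fin r, koszulSign i ∅ = 1 := fun i => by simp [koszulSign]
  constructor
  · intro hf
    have hle : boundaries M x ≤ LinearMap.range (LinearMap.proj ∅ ∘ₗ seriesD M x) := by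
      refine iSup_le fun i => ?_
      rintro _ ⟨g, rfl⟩
      refine ⟨Pi.single {i} g, ?_⟩
      change totalD (mulXSubVar M x) (Pi.single {i} g) ∅ = _
      rw [totalD_apply, Finset.sum_eq_single i]
      · simp [hs]
      · intro j _ hj
        simp [hj]
      · simp
    obtain ⟨b, hb⟩ := hle hf
    exact ⟨b, hb.symm⟩
  · rintro ⟨b, rfl⟩
    rw [totalD_apply]
    refine Submodule.sum_mem _ fun i _ => ?_
    rw [hs, one_smul]
    exact mulXSubVar_mem_boundaries x i _

theorem mulVar_mem_boundaries (x : Fin r → R) (i : Fin r) {f : (Fin r → ℕ) → M}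
    (hf : f ∈ boundaries M x) : mulVar R M i f ∈ boundaries M x := by
  have hle : boundaries M x ≤ (boundaries M x).comap (mulVar R M i) := by
    refine iSup_le fun j => ?_
    rintro _ ⟨g, rfl⟩
    rw [Submodule.mem_comap, ← mulXSubVar_mulVar]
    exact mulXSubVar_mem_boundaries x j _
  exact hle hf

variable (R r M) in
/-- The power series of order at least `n`. -/
def orderGE (n : ℕ) : Submodule R ((Fin r → ℕ) → M) where
  carrier := {f | ∀ α : Fin r → ℕ, ∑ i, α i < n → f α = 0}
  add_mem' hf hg α hα := by rw [Pi.add_apply, hf α hα, hg α hα, add_zero]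
  zero_mem' _ _ := rfl
  smul_mem' c f hf α hα := by rw [Pi.smul_apply, hf α hα, smul_zero]

theorem mulVar_mem_orderGE (i : Fin r) {n : ℕ} {f : (Fin r → ℕ) → M} (hf : f ∈ orderGE R r M n) :
    mulVar R M i f ∈ orderGE R r M (n + 1) := by
  intro α hα
  rw [mulVar_apply]
  split_ifs with h0
  · rfl
  · refine hf _ ?_
    rw [← Finset.add_sum_erase _ _ (Finset.mem_univ i)] at hα ⊢
    rw [Function.update_self, Finset.sum_congr rfl fun j hj =>
      Function.update_of_ne (Finset.ne_of_mem_erase hj) _ _]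
    omega

/-- Modulo `(x - U) M[[U]]`, the ideal `xR` acts like the ideal generated by the variables. -/
theorem pow_smul_top_le (x : Fin r → R) (n : ℕ) :
    (Ideal.span (Set.range x) ^ n • ⊤ : Submodule R ((Fin r → ℕ) → M)) ≤
      boundaries M x ⊔ orderGE R r M n := by
  induction n with
  | zero => exact fun f _ => Submodule.mem_sup_right fun α hα => absurd hα (Nat.not_lt_zero _)
  | succ n ih =>
    rw [pow_succ', Submodule.mul_smul, Submodule.smul_le]
    intro c hc f hf
    have hf := ih hf
    induction hc using Submodule.span_induction with
    | mem c hc =>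
      obtain ⟨i, rfl⟩ := hc
      obtain ⟨g, hg, h, hh, rfl⟩ := Submodule.mem_sup.mp hf
      -- Write `x_i = (x_i - U_i) + U_i`; multiplication by `U_i` preserves the boundaries and
      -- raises the order by one.
      have e : x i • (g + h) = (mulXSubVar M x i (g + h) + mulVar R M i g) + mulVar R M i h := by
        rw [mulXSubVar_eq, map_add]
        abel
      rw [e]
      exact add_mem (Submodule.mem_sup_left (add_mem (mulXSubVar_mem_boundaries x i _)
        (mulVar_mem_boundaries x i hg))) (Submodule.mem_sup_right (mulVar_mem_orderGE i hh))
    | zero => rw [zero_smul]; exact zero_mem _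
    | add c d _ _ hc hd => rw [add_smul]; exact add_mem hc hd
    | smul d c _ hc => rw [smul_assoc]; exact Submodule.smul_mem _ _ hc

theorem iterate_mulVar_apply (i : Fin r) (n : ℕ) (f : (Fin r → ℕ) → M) (α : Fin r → ℕ) :
    (mulVar R M i)^[n] f α = if α i < n then 0 else f (Function.update α i (α i - n)) := by
  induction n generalizing α with
  | zero => simp
  | succ n ih =>
    rw [Function.iterate_succ_apply', mulVar_apply, ih, Function.update_self, Function.update_idem]
    by_cases h0 : α i = 0
    · simp [h0]
    · rw [if_neg h0, Nat.sub_sub, add_comm 1 n]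
      congr 1
      exact propext (by omega)

theorem pow_smul_sub_iterate_mem (x : Fin r → R) (i : Fin r) (n : ℕ) (f : (Fin r → ℕ) → M) :
    x i ^ n • f - (mulVar R M i)^[n] f ∈ boundaries M x := by
  induction n with
  | zero => simp
  | succ n ih =>
    have e : x i ^ (n + 1) • f - (mulVar R M i)^[n + 1] f =
        x i • (x i ^ n • f - (mulVar R M i)^[n] f) + mulXSubVar M x i ((mulVar R M i)^[n] f) := by
      rw [Function.iterate_succ_apply', mulXSubVar_eq, smul_sub, smul_smul, ← pow_succ']
      abel
    rw [e]
    exact add_mem (Submodule.smul_mem _ _ ih) (mulXSubVar_mem_boundaries x i _)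

/-- Splitting off one variable at a time, the part divisible by `U_i ^ n` is congruent to `x_i ^ n`
times a series modulo `(x - U) M[[U]]`. -/
theorem InBox.mem_sup (x : Fin r → R) {n : ℕ} {f : (Fin r → ℕ) → M} (hf : InBox n f) :
    f ∈ boundaries M x ⊔ (Ideal.span (Set.range x) ^ n • ⊤ : Submodule R ((Fin r → ℕ) → M)) := by
  suffices h : ∀ s : Finset (Fin r), ∀ f : (Fin r → ℕ) → M,
      (∀ α : Fin r → ℕ, (∀ i ∈ s, α i < n) → f α = 0) →
      f ∈ boundaries M x ⊔
        (Ideal.span (Set.range x) ^ n • ⊤ : Submodule R ((Fin r → ℕ) → M)) from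
    h Finset.univ f fun α hα => hf α fun i => hα i (Finset.mem_univ i)
  intro s
  induction s using Finset.induction_on with
  | empty =>
    intro f hf
    rw [show f = 0 from funext fun α => hf α (by simp)]
    exact zero_mem _
  | insert i s _ ih =>
    intro f hf
    let g : (Fin r → ℕ) → M := fun α => f (Function.update α i (α i + n))
    let f' : (Fin r → ℕ) → M := fun α => if α i < n then f α else 0
    have e : f = (x i ^ n • g - (x i ^ n • g - (mulVar R M i)^[n] g)) + f' := by
      funext α
      rw [sub_sub_cancel, Pi.add_apply, iterate_mulVar_apply]
      simp only [g, f']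
      split_ifs with h
      · rw [zero_add]
      · rw [add_zero, Function.update_self, Function.update_idem, Nat.sub_add_cancel (not_lt.mp h),
          Function.update_eq_self]
    rw [e]
    refine add_mem (sub_mem (Submodule.mem_sup_right ?_) (Submodule.mem_sup_left ?_)) (ih f' ?_)
    · exact Submodule.smul_mem_smul
        (Ideal.pow_mem_pow (Ideal.subset_span (Set.mem_range_self i)) n) trivial
    · exact pow_smul_sub_iterate_mem x i n g
    · intro α hα
      simp only [f']
      split_ifs with h
      · refine hf α fun j hj => ?_
        rcases Finset.mem_insert.mp hj with rfl | hj
        · exact h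
        · exact hα j hj
      · rfl

/-- The monomial `x ^ α`. -/
def monomialValue (x : Fin r → R) (α : Fin r → ℕ) : R := ∏ i, x i ^ α i

theorem monomialValue_mem (x : Fin r → R) {α : Fin r → ℕ} {n : ℕ} (h : n ≤ ∑ i, α i) :
    monomialValue x α ∈ Ideal.span (Set.range x) ^ n := by
  refine Ideal.pow_le_pow_right h ?_
  rw [← Finset.prod_pow_eq_pow_sum]
  exact Ideal.prod_mem_prod fun i _ =>
    Ideal.pow_mem_pow (Ideal.subset_span (Set.mem_range_self i)) _

theorem monomialValue_update (x : Fin r → R) (α : Fin r → ℕ) (i : Fin r) :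
    monomialValue x (Function.update α i (α i + 1)) = x i * monomialValue x α := by
  rw [monomialValue, monomialValue, ← Finset.mul_prod_erase _ _ (Finset.mem_univ i),
    ← Finset.mul_prod_erase _ (fun j => x j ^ α j) (Finset.mem_univ i), Function.update_self,
    pow_succ', mul_assoc]
  congr 2
  exact Finset.prod_congr rfl fun j hj => by
    rw [Function.update_of_ne (Finset.ne_of_mem_erase hj)]

variable (r) in
/-- The exponents `α` with `α_i < n` for all `i`. -/
def boxExponents (n : ℕ) : Finset (Fin r → ℕ) := Fintype.piFinset fun _ => Finset.range n

theorem mem_boxExponents {n : ℕ} {α : Fin r → ℕ} : α ∈ boxExponents r n ↔ ∀ i, α i < n := by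
  simp [boxExponents]

variable (M) in
/-- The value at `x` of the truncation of a power series at `U_1 ^ n, …, U_r ^ n`. -/
def evalTrunc (x : Fin r → R) (n : ℕ) : ((Fin r → ℕ) → M) →ₗ[R] M :=
  ∑ α ∈ boxExponents r n, monomialValue x α • LinearMap.proj α

theorem evalTrunc_apply (x : Fin r → R) (n : ℕ) (f : (Fin r → ℕ) → M) :
    evalTrunc M x n f = ∑ α ∈ boxExponents r n, monomialValue x α • f α := by
  simp [evalTrunc]

theorem smul_mem_of_le (x : Fin r → R) {α : Fin r → ℕ} {n : ℕ} (h : n ≤ ∑ i, α i) (m : M) :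
    monomialValue x α • m ∈ (Ideal.span (Set.range x) ^ n • ⊤ : Submodule R M) :=
  Submodule.smul_mem_smul (monomialValue_mem x h) trivial

theorem evalTrunc_sub_mem (x : Fin r → R) {n m : ℕ} (h : n ≤ m) (f : (Fin r → ℕ) → M) :
    evalTrunc M x m f - evalTrunc M x n f ∈
      (Ideal.span (Set.range x) ^ n • ⊤ : Submodule R M) := by
  have hsub : boxExponents r n ⊆ boxExponents r m := fun α hα =>
    mem_boxExponents.mpr fun i => (mem_boxExponents.mp hα i).trans_le h
  rw [evalTrunc_apply, evalTrunc_apply, ← Finset.sum_sdiff hsub, add_sub_cancel_right]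
  refine Submodule.sum_mem _ fun α hα => smul_mem_of_le x ?_ _
  have := (Finset.mem_sdiff.mp hα).2
  rw [mem_boxExponents] at this
  push Not at this
  obtain ⟨i, hi⟩ := this
  exact hi.trans (Finset.single_le_sum (fun _ _ => Nat.zero_le _) (Finset.mem_univ i))

theorem evalTrunc_of_orderGE (x : Fin r → R) {n : ℕ} {f : (Fin r → ℕ) → M}
    (hf : f ∈ orderGE R r M n) :
    evalTrunc M x n f ∈ (Ideal.span (Set.range x) ^ n • ⊤ : Submodule R M) := by
  rw [evalTrunc_apply]
  refine Submodule.sum_mem _ fun α _ => ?_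
  by_cases h : ∑ i, α i < n
  · rw [hf α h, smul_zero]
    exact zero_mem _
  · exact smul_mem_of_le x (not_lt.mp h) _

theorem evalTrunc_of_inBox (x : Fin r → R) {n : ℕ} {f : (Fin r → ℕ) → M} (hf : InBox n f) :
    evalTrunc M x n f = 0 := by
  rw [evalTrunc_apply]
  exact Finset.sum_eq_zero fun α hα => by rw [hf α (mem_boxExponents.mp hα), smul_zero]

/-- Evaluation at `x` cancels `x_i` against `U_i`, except for the edge terms with `α i + 1 ≥ n`
created by the truncation; these carry a monomial of degree at least `n`. -/
theorem evalTrunc_of_boundaries (x : Fin r → R) (n : ℕ) {f : (Fin r → ℕ) → M}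
    (hf : f ∈ boundaries M x) :
    evalTrunc M x n f ∈ (Ideal.span (Set.range x) ^ n • ⊤ : Submodule R M) := by
  have hle : boundaries M x ≤
      (Ideal.span (Set.range x) ^ n • ⊤ : Submodule R M).comap (evalTrunc M x n) := by
    refine iSup_le fun i => ?_
    rintro _ ⟨g, rfl⟩
    rw [Submodule.mem_comap, evalTrunc_apply]
    have e1 : ∑ α ∈ boxExponents r n, monomialValue x α • mulXSubVar M x i g α =
        ∑ α ∈ boxExponents r n, (x i * monomialValue x α) • g α -
          ∑ α ∈ boxExponents r n with α i ≠ 0,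
            monomialValue x α • g (Function.update α i (α i - 1)) := by
      rw [Finset.sum_filter, ← Finset.sum_sub_distrib]
      refine Finset.sum_congr rfl fun α _ => ?_
      rw [mulXSubVar_apply, smul_sub, smul_smul, mul_comm]
      congr 1
      by_cases h0 : α i = 0 <;> simp [h0]
    have e2 : ∑ α ∈ boxExponents r n with α i ≠ 0,
        monomialValue x α • g (Function.update α i (α i - 1)) =
        ∑ α ∈ boxExponents r n with α i + 1 < n, (x i * monomialValue x α) • g α := by
      refine Finset.sum_bij' (fun α _ => Function.update α i (α i - 1))
        (fun α _ => Function.update α i (α i + 1)) ?_ ?_ ?_ ?_ ?_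
      · intro α hα
        rw [Finset.mem_filter, mem_boxExponents] at hα ⊢
        rw [Function.update_self]
        refine ⟨fun j => ?_, by have := hα.1 i; omega⟩
        by_cases hj : j = i
        · subst hj
          rw [Function.update_self]
          have := hα.1 j
          omega
        · rw [Function.update_of_ne hj]
          exact hα.1 j
      · intro α hα
        rw [Finset.mem_filter, mem_boxExponents] at hα ⊢
        rw [Function.update_self]
        refine ⟨fun j => ?_, by omega⟩
        by_cases hj : j = i
        · subst hj
          rw [Function.update_self]
          exact hα.2
        · rw [Function.update_of_ne hj]
          exact hα.1 j
      · intro α hα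
        have h0 := (Finset.mem_filter.mp hα).2
        rw [Function.update_self, Function.update_idem,
          Nat.sub_add_cancel (Nat.pos_of_ne_zero h0), Function.update_eq_self]
      · intro α hα
        rw [Function.update_self, Function.update_idem, Nat.add_sub_cancel,
          Function.update_eq_self]
      · intro α hα
        have h0 := (Finset.mem_filter.mp hα).2
        rw [← monomialValue_update, Function.update_self, Function.update_idem,
          Nat.sub_add_cancel (Nat.pos_of_ne_zero h0), Function.update_eq_self]
    rw [e1, e2, ← Finset.sum_filter_add_sum_filter_not _ (fun α => α i + 1 < n),
      add_sub_cancel_left]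
    refine Submodule.sum_mem _ fun α hα => ?_
    rw [← monomialValue_update]
    refine smul_mem_of_le x ?_ _
    have h := (Finset.mem_filter.mp hα).2
    calc n ≤ α i + 1 := not_lt.mp h
      _ = Function.update α i (α i + 1) i := (Function.update_self i _ α).symm
      _ ≤ _ := Finset.single_le_sum (fun _ _ => Nat.zero_le _) (Finset.mem_univ i)
  exact hle hf

theorem evalTrunc_single (x : Fin r → R) {n : ℕ} (hn : 0 < n) (m : M) :
    evalTrunc M x n (Pi.single 0 m) = m := by
  rw [evalTrunc_apply, Finset.sum_eq_single_of_mem 0 (mem_boxExponents.mpr fun _ => hn)]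
  · simp [monomialValue]
  · intro α _ hα
    simp [hα]

theorem single_mem_of_mem (x : Fin r → R) (n : ℕ) {m : M}
    (hm : m ∈ (Ideal.span (Set.range x) ^ n • ⊤ : Submodule R M)) :
    (Pi.single 0 m : (Fin r → ℕ) → M) ∈ boundaries M x ⊔ orderGE R r M n := by
  refine pow_smul_top_le x n ?_
  have := Submodule.mem_map_of_mem (f := LinearMap.single R (fun _ : Fin r → ℕ => M) 0) hm
  rw [Submodule.map_smul''] at this
  exact Submodule.smul_mono le_rfl le_top this

variable (M) in
/-- The map `M[[U]] → Λ^x(M)` which sends a power series to its value at `x`. -/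
noncomputable def evalSeries (x : Fin r → R) : ((Fin r → ℕ) → M) →ₗ[R] completion x M :=
  AdicCompletion.lift _ (fun n => Submodule.mkQ _ ∘ₗ evalTrunc M x n) (by
    intro m n h
    refine LinearMap.ext fun f => ?_
    change Submodule.Quotient.mk (evalTrunc M x n f) = Submodule.Quotient.mk (evalTrunc M x m f)
    rw [Submodule.Quotient.eq]
    exact evalTrunc_sub_mem x h f)

theorem evalSeries_val (x : Fin r → R) (f : (Fin r → ℕ) → M) (n : ℕ) :
    (evalSeries M x f).val n = Submodule.Quotient.mk (evalTrunc M x n f) := rfl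

theorem evalSeries_eq_zero_iff (x : Fin r → R) (f : (Fin r → ℕ) → M) :
    evalSeries M x f = 0 ↔
      ∀ n, evalTrunc M x n f ∈ (Ideal.span (Set.range x) ^ n • ⊤ : Submodule R M) := by
  rw [AdicCompletion.ext_iff]
  refine forall_congr' fun n => ?_
  rw [evalSeries_val, AdicCompletion.val_zero_apply, Submodule.Quotient.mk_eq_zero]

/-- The successive differences of a Cauchy sequence lie in `(xR) ^ n M`. Modulo boundaries, each can
be replaced by a series of order at least `n`, and these series can be summed. -/
theorem evalSeries_surjective (x : Fin r → R) : Function.Surjective (evalSeries M x) := by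
  intro y
  induction y using AdicCompletion.induction_on with
  | _ m =>
  have hm : ∀ n, m (n + 1) - m n ∈ (Ideal.span (Set.range x) ^ n • ⊤ : Submodule R M) := by
    intro n
    rw [← Submodule.Quotient.eq]
    exact (m.2 (Nat.le_succ n)).symm
  choose b hb f hf hbf using fun n => Submodule.mem_sup.mp (single_mem_of_mem x n (hm n))
  let F : (Fin r → ℕ) → M := fun α =>
    (Pi.single 0 (m 0) : (Fin r → ℕ) → M) α + ∑ n ∈ Finset.range (∑ i, α i + 1), f n α
  refine ⟨F, ?_⟩
  rw [AdicCompletion.ext_iff]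
  intro N
  rw [evalSeries_val, AdicCompletion.mk_apply_coe, Submodule.mkQ_apply, Submodule.Quotient.eq]
  rcases Nat.eq_zero_or_pos N with rfl | hN
  · simp
  have hF : F - (Pi.single 0 (m 0) + ∑ n ∈ Finset.range N, f n) ∈ orderGE R r M N := by
    intro α hα
    simp only [F, Pi.sub_apply, Pi.add_apply, Finset.sum_apply]
    rw [add_sub_add_left_eq_sub, sub_eq_zero]
    refine Finset.sum_subset (Finset.range_mono hα) fun n _ hn => ?_
    exact hf n α (by simpa using hn)
  have hs : ∀ N, Pi.single 0 (m 0) + ∑ n ∈ Finset.range N, f n =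
      Pi.single 0 (m N) - ∑ n ∈ Finset.range N, b n := by
    intro N
    induction N with
    | zero => simp
    | succ N ih =>
      rw [Finset.sum_range_succ, Finset.sum_range_succ, ← add_assoc, ih, ← sub_sub,
        eq_sub_iff_add_eq, add_assoc, add_comm (f N), hbf, Pi.single_sub]
      abel
  rw [hs] at hF
  have h1 := evalTrunc_of_orderGE x hF
  have h2 := evalTrunc_of_boundaries x N
    (Submodule.sum_mem (boundaries M x) fun n (_ : n ∈ Finset.range N) => hb n)
  rw [map_sub, map_sub, evalTrunc_single x hN] at h1
  have := sub_mem h1 h2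
  rwa [sub_sub, sub_add_cancel] at this

theorem evalSeries_boundaries (x : Fin r → R) {f : (Fin r → ℕ) → M} (hf : f ∈ boundaries M x) :
    evalSeries M x f = 0 :=
  (evalSeries_eq_zero_iff x f).mpr fun n => evalTrunc_of_boundaries x n hf

/-- A series with value zero at `x` is a boundary modulo every truncation: its normal form is a
constant in a high power of `xR`, hence congruent to a series of high order. The passage to the
limit then makes it a boundary. -/
theorem SeriesProZero.mem_boundaries {x : Fin r → R} (h : SeriesProZero x M 0)
    {f : (Fin r → ℕ) → M} (hf : evalSeries M x f = 0) : f ∈ boundaries M x := by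
  rw [evalSeries_eq_zero_iff] at hf
  obtain ⟨b, hb⟩ := h.exists_seriesD_eq (fun _ => f) fun n => by
    -- Exponents in the box of size `n` have total degree at most `r * n < N`, so series of order at
    -- least `N` vanish there. The choice also gives `N > 0` and `n ≤ N`.
    obtain ⟨N, hN⟩ : ∃ N, N = n * (r + 1) + 1 := ⟨_, rfl⟩
    obtain ⟨a', b, h1, -, h3⟩ := exists_isNormal x (n := N) (p := 0) (by omega)
      (fun _ => f) (fun T hT => absurd hT (by omega))
    have h3 : InBox N (f - a' ∅ - seriesD M x b ∅) := h3 ∅ Finset.card_empty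
    have h4 : InBox N (a' ∅ - Pi.single 0 (a' ∅ 0)) := by
      intro α hα
      by_cases h0 : α = 0
      · subst h0
        simp
      · obtain ⟨i, hi⟩ := Function.ne_iff.mp h0
        rw [Pi.sub_apply, Pi.single_eq_of_ne h0, sub_zero]
        exact (h1 i ∅ α (hα i)).2 (Finset.notMem_empty i) hi
    have h5 : a' ∅ 0 ∈ (Ideal.span (Set.range x) ^ N • ⊤ : Submodule R M) := by
      have e1 := evalTrunc_of_inBox x (h3.add h4)
      rw [sub_add_sub_comm, add_comm (seriesD M x b ∅), ← sub_sub, sub_add_cancel, map_sub,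
        map_sub, evalTrunc_single x (by omega), sub_eq_zero, sub_eq_iff_eq_add'] at e1
      have e2 := evalTrunc_of_boundaries x N
        ((mem_boundaries_iff x (seriesD M x b ∅)).mpr ⟨b, rfl⟩)
      have e3 := sub_mem (hf N) e2
      rwa [e1, add_sub_cancel_right] at e3
    obtain ⟨g, hg, k, hk, hgk⟩ := Submodule.mem_sup.mp (single_mem_of_mem x N h5)
    obtain ⟨b', rfl⟩ := (mem_boundaries_iff x g).mp hg
    have h6 : InBox n k := by
      intro α hα
      refine hk α ?_
      calc ∑ i, α i ≤ ∑ _i : Fin r, n := Finset.sum_le_sum fun i _ => (hα i).le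
        _ < N := by
          rw [Finset.sum_const, Finset.card_univ, Fintype.card_fin, smul_eq_mul, hN, mul_comm]
          exact Nat.lt_succ_of_le (Nat.mul_le_mul_left n (Nat.le_succ r))
    refine ⟨b + b', fun S hS => ?_⟩
    rw [Finset.card_eq_zero] at hS
    subst hS
    have hnN : n ≤ N := by
      rw [hN]
      exact (Nat.le_mul_of_pos_right n (Nat.succ_pos r)).trans (Nat.le_succ _)
    have h7 := ((h3.add h4).mono hnN).add h6
    have e : f - a' ∅ - seriesD M x b ∅ + (a' ∅ - Pi.single 0 (a' ∅ 0)) + k =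
        f - (seriesD M x b ∅ + seriesD M x b' ∅) := by
      rw [← hgk]
      abel
    rw [e] at h7
    rwa [Pi.sub_apply, map_add]
  exact (mem_boundaries_iff x f).mpr ⟨b, hb ∅ Finset.card_empty⟩

/-- If `M[[U]] / (x - U) M[[U]]` embeds into the completion of `M`, it is separated. -/
theorem mem_boundaries_of_inBox (x : Fin r → R)
    (g : ((Fin r → ℕ) → M) →ₗ[R] completion x M) (hg : LinearMap.ker g = boundaries M x)
    {f : (Fin r → ℕ) → M} (hf : ∀ n, ∃ b, InBox n (f - seriesD M x b ∅)) :
    f ∈ boundaries M x := by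
  rw [← hg, LinearMap.mem_ker]
  -- The completion is `xR`-adically separated, and truncation errors lie in `(xR) ^ n M[[U]]` up to
  -- boundaries, so linearity of `g` suffices.
  refine IsHausdorff.haus (I := Ideal.span (Set.range x)) inferInstance _ fun n => ?_
  rw [SModEq.zero]
  obtain ⟨b, hb⟩ := hf n
  obtain ⟨y, hy, z, hz, hyz⟩ := Submodule.mem_sup.mp (hb.mem_sup x)
  have h1 : g (seriesD M x b ∅) = 0 := by
    rw [← LinearMap.mem_ker, hg]
    exact (mem_boundaries_iff x _).mpr ⟨b, rfl⟩
  have h2 : g y = 0 := by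
    rwa [← LinearMap.mem_ker, hg]
  have h3 := Submodule.mem_map_of_mem (f := g) hz
  rw [Submodule.map_smul''] at h3
  have h4 : g f = g z := by
    have := congrArg g hyz
    rw [map_add, map_sub, h1, h2, zero_add, sub_zero] at this
    exact this.symm
  rw [h4]
  exact Submodule.smul_mono le_rfl le_top h3

end DegreeZero

section Category

variable {R : Type u} [CommRing R]

/-! ### Elementwise descriptions of the homological conditions -/

/-- The target is exact in positive degrees, so only exactness of `X` is required there; in degree
`0` the condition is that the augmentation is a cokernel of the last differential. -/
theorem isLeftResolution_iff (X : ChainComplex (ModuleCat.{w} R) ℕ)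
    (N : Type w) [AddCommGroup N] [Module R N] :
    IsLeftResolution X N ↔
      (∀ p, Function.Exact (X.d (p + 1 + 1) (p + 1)).hom (X.d (p + 1) p).hom) ∧
      ∃ g : X.X 0 →ₗ[R] N, Function.Surjective g ∧ Function.Exact (X.d 1 0).hom g := by
  have hsucc : ∀ (f : X ⟶ (ChainComplex.single₀ (ModuleCat.{w} R)).obj (ModuleCat.of R N)) (p : ℕ),
      QuasiIsoAt f (p + 1) ↔
        Function.Exact (X.d (p + 1 + 1) (p + 1)).hom (X.d (p + 1) p).hom := by
    intro f p
    rw [quasiIsoAt_iff_exactAt' (hL := ChainComplex.exactAt_succ_single_obj ..),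
      HomologicalComplex.exactAt_iff' _ (p + 1 + 1) (p + 1) p (by simp) (by simp),
      ShortComplex.moduleCat_exact_iff_range_eq_ker, LinearMap.exact_iff]
    exact eq_comm
  have hzero : ∀ f : X ⟶ (ChainComplex.single₀ (ModuleCat.{w} R)).obj (ModuleCat.of R N),
      QuasiIsoAt f 0 ↔
        Function.Surjective (f.f 0).hom ∧ Function.Exact (X.d 1 0).hom (f.f 0).hom := by
    intro f
    rw [ChainComplex.quasiIsoAt₀_iff, ShortComplex.quasiIso_iff_of_zeros']
    · rw [ModuleCat.epi_iff_surjective, ShortComplex.moduleCat_exact_iff_range_eq_ker,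
        LinearMap.exact_iff, and_comm]
      exact and_congr Iff.rfl eq_comm
    · exact X.shape 0 0 (by simp)
    · rfl
    · rfl
  constructor
  · rintro ⟨f, hf⟩
    rw [quasiIso_iff] at hf
    exact ⟨fun p => (hsucc f p).mp (hf (p + 1)), (f.f 0).hom, (hzero f).mp (hf 0)⟩
  · rintro ⟨h1, g, h2, h3⟩
    let f := (ChainComplex.toSingle₀Equiv X (ModuleCat.of R N)).symm
      ⟨ModuleCat.ofHom g, by
        ext z
        exact h3.apply_apply_eq_zero z⟩
    have hf : f.f 0 = ModuleCat.ofHom g := ChainComplex.toSingle₀Equiv_symm_apply_f_zero _ _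
    refine ⟨f, (quasiIso_iff f).mpr fun i => ?_⟩
    cases i with
    | zero =>
      rw [hzero, hf]
      exact ⟨h2, h3⟩
    | succ p => exact (hsucc f p).mpr (h1 p)

/-- Cycles map epimorphically onto homology, and homology embeds into the chains modulo boundaries,
so vanishing can be tested on the composite from cycles to `opcycles`. -/
theorem homologyMap_eq_zero_iff {K L : ChainComplex (ModuleCat.{w} R) ℕ} (f : K ⟶ L) (p : ℕ) :
    HomologicalComplex.homologyMap f (p + 1) = 0 ↔
      ∀ z : K.X (p + 1), (K.d (p + 1) p).hom z = 0 →
        ∃ y : L.X (p + 1 + 1), (f.f (p + 1)).hom z = (L.d (p + 1 + 1) (p + 1)).hom y := by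
  have h1 : HomologicalComplex.homologyMap f (p + 1) = 0 ↔
      K.iCycles (p + 1) ≫ f.f (p + 1) ≫ L.pOpcycles (p + 1) = 0 := by
    rw [← cancel_epi (K.homologyπ (p + 1)), ← cancel_mono (L.homologyι (p + 1)),
      Limits.comp_zero, Limits.zero_comp, HomologicalComplex.homologyπ_naturality,
      Category.assoc, HomologicalComplex.homology_π_ι, HomologicalComplex.cyclesMap_i_assoc]
  have h2 : ∀ y : L.X (p + 1), (L.pOpcycles (p + 1)).hom y = 0 ↔
      ∃ z, y = (L.d (p + 1 + 1) (p + 1)).hom z := by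
    intro y
    constructor
    · intro hy
      let q : L.X (p + 1) ⟶
          ModuleCat.of R (L.X (p + 1) ⧸ LinearMap.range (L.d (p + 1 + 1) (p + 1)).hom) :=
        ModuleCat.ofHom (Submodule.mkQ _)
      have hq : L.d (p + 1 + 1) (p + 1) ≫ q = 0 := by
        ext z
        exact (Submodule.Quotient.mk_eq_zero _).mpr ⟨z, rfl⟩
      have e := LinearMap.congr_fun (congrArg ModuleCat.Hom.hom
        (L.p_descOpcycles q (p + 1 + 1) (by simp) hq)) y
      rw [ModuleCat.hom_comp, LinearMap.comp_apply, hy, map_zero] at e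
      obtain ⟨z, hz⟩ := (Submodule.Quotient.mk_eq_zero _).mp e.symm
      exact ⟨z, hz.symm⟩
    · rintro ⟨z, rfl⟩
      exact LinearMap.congr_fun (congrArg ModuleCat.Hom.hom
        (L.d_pOpcycles (p + 1 + 1) (p + 1))) z
  rw [h1]
  constructor
  · intro h z hz
    rw [← h2]
    let k : ModuleCat.of R (LinearMap.ker (K.d (p + 1) p).hom) ⟶ K.X (p + 1) :=
      ModuleCat.ofHom (Submodule.subtype _)
    have hk : k ≫ K.d (p + 1) p = 0 := by
      ext z
      exact z.2
    have e : k ≫ f.f (p + 1) ≫ L.pOpcycles (p + 1) = 0 := by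
      rw [← K.liftCycles_i k p (by simp) hk, Category.assoc, h, Limits.comp_zero]
    exact LinearMap.congr_fun (congrArg ModuleCat.Hom.hom e) ⟨z, hz⟩
  · intro h
    ext z
    refine (h2 _).mpr (h _ ?_)
    exact LinearMap.congr_fun (congrArg ModuleCat.Hom.hom (K.iCycles_d (p + 1) p)) z

end Category

section Graded

variable {R : Type u} [CommRing R] {r : ℕ} {M : Type w} [AddCommGroup M] [Module R M]

/-! ### From the graded complexes to the total complexes -/

theorem exists_extension {N : Type*} [Zero N] {p : ℕ} (f : Subsets r p → N) :
    ∃ a : Finset (Fin r) → N, f = fun S => a S.1 := by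
  refine ⟨fun S => if h : S.card = p then f ⟨S, h⟩ else 0, funext fun S => ?_⟩
  simp [S.2]

theorem koszulD_restrict (x : Fin r → R) (p : ℕ) (a : Finset (Fin r) → M) (T : Subsets r p) :
    koszulD x M p (fun S => a S.1) T = totalD (fun i => x i • (LinearMap.id : M →ₗ[R] M)) a T.1 :=
  (Finset.sum_subtype (T.1)ᶜ (fun _ => Finset.mem_compl)
    fun i => koszulSign i T.1 • x i • a (insert i T.1)).symm

theorem isWeaklyProregular_iff (x : Fin r → R) :
    IsWeaklyProregular x M ↔ ∀ p, KoszulProZero x M p := by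
  have key : ∀ (p n m : ℕ) (h : n ≤ m),
      HomologicalComplex.homologyMap (koszulPowMap x M h) (p + 1) = 0 ↔
        ∀ c : Finset (Fin r) → M, (∀ T : Finset (Fin r), T.card = p → powD M x m c T = 0) →
        ∃ e, ∀ S : Finset (Fin r), S.card = p + 1 →
          (∏ i ∈ S, x i ^ (m - n)) • c S = powD M x n e S := by
    intro p n m h
    rw [homologyMap_eq_zero_iff]
    have hd : ∀ (k q : ℕ), (koszulComplex (fun i => x i ^ k) M).d (q + 1) q =
        ModuleCat.ofHom (koszulD (fun i => x i ^ k) M q) := fun k q => by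
      simp only [koszulComplex, ChainComplex.of_d]
    rw [hd, hd]
    constructor
    · intro H c hc
      obtain ⟨y, hy⟩ := H (fun S : Subsets r (p + 1) => c S.1) (funext fun T => by
        exact (koszulD_restrict _ p c T).trans (hc T.1 T.2))
      obtain ⟨e, rfl⟩ := exists_extension y
      exact ⟨e, fun S hS => (congrFun hy ⟨S, hS⟩).trans (koszulD_restrict _ (p + 1) e ⟨S, hS⟩)⟩
    · intro H z hz
      obtain ⟨c, rfl⟩ := exists_extension z
      obtain ⟨e, he⟩ := H c fun T hT =>
        (koszulD_restrict _ p c ⟨T, hT⟩).symm.trans (congrFun hz ⟨T, hT⟩)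
      refine ⟨fun S : Subsets r (p + 1 + 1) => e S.1, funext fun S => ?_⟩
      exact (he S.1 S.2).trans (koszulD_restrict _ (p + 1) e S).symm
  constructor
  · intro H p n
    obtain ⟨m, h, hm⟩ := H (p + 1) (Nat.succ_pos p) n
    exact ⟨m, h, (key p n m h).mp hm⟩
  · intro H i hi n
    obtain ⟨p, rfl⟩ : ∃ p, i = p + 1 := ⟨i - 1, by omega⟩
    obtain ⟨m, h, hm⟩ := H p n
    exact ⟨m, h, (key p n m h).mpr hm⟩

/-! ### Functionals on inverse polynomials as power series -/

theorem koszulCoD_single {N : Type*} [AddCommGroup N] [Module R N] (φ : Fin r → Module.End R N)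
    {p : ℕ} (T : Subsets r p) (u : N) :
    koszulCoD φ p (Pi.single T u) =
      ∑ i : {i : Fin r // i ∉ T.1}, koszulSign i.1 T.1 • Pi.single (T.insert i) (φ i.1 u) := by
  funext S
  rw [Finset.sum_apply]
  change ∑ i : {i : Fin r // i ∈ S.1}, koszulSign i.1 S.1 • φ i.1
    ((Pi.single T u : Subsets r p → N) (S.erase i)) = _
  by_cases h : ∃ i : {i : Fin r // i ∉ T.1}, S = T.insert i
  · obtain ⟨i, rfl⟩ := h
    have hi : i.1 ∈ (T.insert i).1 := Finset.mem_insert_self _ _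
    have he : (T.insert i).erase ⟨i.1, hi⟩ = T := Subtype.ext (Finset.erase_insert i.2)
    rw [Finset.sum_eq_single ⟨i.1, hi⟩, Finset.sum_eq_single i, he, Pi.single_eq_same,
      Pi.smul_apply, Pi.single_eq_same, koszulSign_erase]
    · exact congrArg (fun A => koszulSign i.1 A • φ i.1 u) (Finset.erase_insert i.2)
    · intro j _ hj
      rw [Pi.smul_apply, Pi.single_eq_of_ne, smul_zero]
      intro e
      have : j.1 ∈ (T.insert i).1 := by
        rw [e]
        exact Finset.mem_insert_self _ _
      exact hj (Subtype.ext ((Finset.mem_insert.mp this).resolve_right j.2))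
    · simp
    · intro j _ hj
      rw [Pi.single_eq_of_ne, map_zero, smul_zero]
      intro e
      have : i.1 ∈ ((T.insert i).erase j).1 :=
        Finset.mem_erase.mpr ⟨fun e' => hj (Subtype.ext e'.symm), hi⟩
      rw [e] at this
      exact i.2 this
    · simp
  · push Not at h
    rw [Finset.sum_eq_zero, Finset.sum_eq_zero]
    · intro i _
      rw [Pi.smul_apply, Pi.single_eq_of_ne (h i), smul_zero]
    · intro i _
      rw [Pi.single_eq_of_ne, map_zero, smul_zero]
      rintro rfl
      exact h ⟨i.1, Finset.notMem_erase _ _⟩ (Subtype.ext (Finset.insert_erase i.2).symm)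

theorem mulU_single (i : Fin r) (α : Fin r → ℕ) :
    mulU R i (Finsupp.single (Finsupp.equivFunOnFinite.symm α) 1) =
      if α i = 0 then 0
      else Finsupp.single (Finsupp.equivFunOnFinite.symm (Function.update α i (α i - 1))) 1 := by
  ext β
  change (Finsupp.single (Finsupp.equivFunOnFinite.symm α) (1 : R)) (β + Finsupp.single i 1) = _
  split_ifs with h0
  · rw [Finsupp.single_apply, if_neg]
    · rfl
    · intro e
      have := DFunLike.congr_fun e i
      simp [h0] at this
  · rw [Finsupp.single_apply, Finsupp.single_apply]
    congr 1
    rw [eq_iff_iff]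
    constructor
    · intro e
      ext j
      have := DFunLike.congr_fun e j
      by_cases hj : j = i
      · subst hj
        simp at this
        simp
        omega
      · simpa [hj, Finsupp.single_apply, Ne.symm hj] using this
    · intro e
      ext j
      have := DFunLike.congr_fun e j
      by_cases hj : j = i
      · subst hj
        simp at this
        simp
        omega
      · simpa [hj, Finsupp.single_apply, Ne.symm hj] using this

variable (R M) in
/-- The isomorphism between `Hom_R(⨁_S R[U⁻¹], M)` and families of power series, on the level of
families indexed by all sets. -/
noncomputable def homCoeff (p : ℕ) :
    ((Subsets r p → InvPoly R r) →ₗ[R] M) →ₗ[R] (Finset (Fin r) → (Fin r → ℕ) → M) where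
  toFun g S α := if h : S.card = p then
    g (Pi.single ⟨S, h⟩ (Finsupp.single (Finsupp.equivFunOnFinite.symm α) 1)) else 0
  map_add' g g' := by
    ext S α
    simp only [Pi.add_apply]
    split_ifs <;> simp
  map_smul' c g := by
    ext S α
    simp

theorem homCoeff_apply {p : ℕ} (g : (Subsets r p → InvPoly R r) →ₗ[R] M) (S : Subsets r p)
    (α : Fin r → ℕ) : homCoeff R M p g S.1 α =
      g (Pi.single S (Finsupp.single (Finsupp.equivFunOnFinite.symm α) 1)) := dif_pos S.2

theorem homCoeff_ext {p : ℕ} {g g' : (Subsets r p → InvPoly R r) →ₗ[R] M}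
    (h : ∀ S : Finset (Fin r), S.card = p → homCoeff R M p g S = homCoeff R M p g' S) :
    g = g' := by
  refine LinearMap.pi_ext' fun S => Finsupp.lhom_ext' fun α => LinearMap.ext_ring ?_
  have := congrFun (h S.1 S.2) α
  rw [homCoeff_apply, homCoeff_apply, Finsupp.equivFunOnFinite_symm_coe] at this
  exact this

theorem exists_homCoeff (p : ℕ) (a : Finset (Fin r) → (Fin r → ℕ) → M) :
    ∃ g, ∀ S : Finset (Fin r), S.card = p → homCoeff R M p g S = a S := by
  classical
  refine ⟨LinearMap.lsum R (fun _ : Subsets r p => InvPoly R r) R fun S =>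
    Finsupp.lift M R _ fun α => a S.1 α, fun S hS => funext fun α => ?_⟩
  refine (homCoeff_apply _ ⟨S, hS⟩ α).trans ?_
  rw [LinearMap.lsum_piSingle, Finsupp.lift_apply, Finsupp.sum_single_index (by simp), one_smul]
  rfl

/-- Lowering exponents in `R[U⁻¹]` is transposed to multiplication by `U_i` on coefficient families,
so dualizing the co-complex gives the Koszul complex on `M[[U]]`. -/
theorem homCoeff_comp_koszulCoD (x : Fin r → R) {p : ℕ}
    (g : (Subsets r (p + 1) → InvPoly R r) →ₗ[R] M) {T : Finset (Fin r)} (hT : T.card = p) :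
    homCoeff R M p (g ∘ₗ koszulCoD (mulXSubU x) p) T = seriesD M x (homCoeff R M (p + 1) g) T := by
  funext α
  refine (homCoeff_apply _ ⟨T, hT⟩ α).trans ?_
  rw [LinearMap.comp_apply, koszulCoD_single, map_sum, seriesD_apply,
    Finset.sum_subtype Tᶜ fun _ => Finset.mem_compl]
  refine Finset.sum_congr rfl fun i _ => ?_
  have hc := homCoeff_apply g (Subsets.insert ⟨T, hT⟩ i)
  rw [map_zsmul, mulXSubVar_apply]
  congr 1
  have e : mulXSubU x i.1 (Finsupp.single (Finsupp.equivFunOnFinite.symm α) 1) =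
      x i.1 • Finsupp.single (Finsupp.equivFunOnFinite.symm α) 1 -
        mulU R i.1 (Finsupp.single (Finsupp.equivFunOnFinite.symm α) 1) := rfl
  rw [e, mulU_single, Pi.single_sub, map_sub, Pi.single_smul, map_smul, ← hc]
  congr 1
  split_ifs
  · rw [Pi.single_zero, map_zero]
  · rw [← hc]
    rfl

end Graded

/-! ### The left resolution property and weak pro-regularity -/

section LeftResolution

variable {R : Type u} [CommRing R] {r : ℕ}

theorem range_lcomp_koszulCoD_iff (x : Fin r → R) {M : Type w} [AddCommGroup M] [Module R M]
    {p : ℕ} (g : (Subsets r p → InvPoly R r) →ₗ[R] M) :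
    g ∈ Set.range (LinearMap.lcomp R M (koszulCoD (mulXSubU x) p)) ↔
      ∃ b, ∀ S : Finset (Fin r), S.card = p → homCoeff R M p g S = seriesD M x b S := by
  constructor
  · rintro ⟨y, rfl⟩
    exact ⟨homCoeff R M (p + 1) y, fun S hS => homCoeff_comp_koszulCoD x y hS⟩
  · rintro ⟨b, hb⟩
    obtain ⟨y, hy⟩ := exists_homCoeff (R := R) (p + 1) b
    refine ⟨y, homCoeff_ext fun S hS => ?_⟩
    rw [hb S hS, ← totalD_congr _ hy hS]
    exact homCoeff_comp_koszulCoD x y hS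

theorem lcomp_koszulCoD_eq_zero_iff (x : Fin r → R) {M : Type w} [AddCommGroup M] [Module R M]
    {p : ℕ} (g : (Subsets r (p + 1) → InvPoly R r) →ₗ[R] M) :
    LinearMap.lcomp R M (koszulCoD (mulXSubU x) p) g = 0 ↔
      ∀ T : Finset (Fin r), T.card = p → seriesD M x (homCoeff R M (p + 1) g) T = 0 := by
  constructor
  · intro h T hT
    rw [← homCoeff_comp_koszulCoD x g hT]
    exact congrFun ((congrArg (homCoeff R M p) h).trans (map_zero _)) T
  · intro h
    refine homCoeff_ext fun T hT => ?_
    rw [map_zero]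
    exact (homCoeff_comp_koszulCoD x g hT).trans (h T hT)

variable (R r) in
/-- The isomorphism `Hom_R(R[U⁻¹], M) ≃ M[[U]]` in degree zero. -/
noncomputable def homEquivSeries (M : Type w) [AddCommGroup M] [Module R M] :
    ((Subsets r 0 → InvPoly R r) →ₗ[R] M) ≃ₗ[R] ((Fin r → ℕ) → M) :=
  LinearEquiv.ofBijective (LinearMap.proj ∅ ∘ₗ homCoeff R M 0) (by
    constructor
    · intro g g' h
      refine homCoeff_ext fun S hS => ?_
      rw [Finset.card_eq_zero.mp hS]
      exact h
    · intro f
      obtain ⟨g, hg⟩ := exists_homCoeff (R := R) 0 fun _ => f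
      exact ⟨g, hg ∅ Finset.card_empty⟩)

theorem homEquivSeries_mem_boundaries_iff (x : Fin r → R) {M : Type w} [AddCommGroup M]
    [Module R M] (g : (Subsets r 0 → InvPoly R r) →ₗ[R] M) :
    homEquivSeries R r M g ∈ boundaries M x ↔
      g ∈ Set.range (LinearMap.lcomp R M (koszulCoD (mulXSubU x) 0)) := by
  rw [range_lcomp_koszulCoD_iff, mem_boundaries_iff]
  refine exists_congr fun b => ⟨fun h S hS => ?_, fun h => h ∅ Finset.card_empty⟩
  rw [Finset.card_eq_zero.mp hS]
  exact h

theorem isLeftResolution_homComplex_iff_exact (x : Fin r → R) (M : Type (max u v))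
    [AddCommGroup M] [Module R M] (N : Type (max u v)) [AddCommGroup N] [Module R N] :
    IsLeftResolution (homComplex (cechResolution x) M) N ↔
      (∀ p, Function.Exact (LinearMap.lcomp R M (koszulCoD (mulXSubU x) (p + 1)))
        (LinearMap.lcomp R M (koszulCoD (mulXSubU x) p))) ∧
      ∃ g : ((Subsets r 0 → InvPoly R r) →ₗ[R] M) →ₗ[R] N, Function.Surjective g ∧
        Function.Exact (LinearMap.lcomp R M (koszulCoD (mulXSubU x) 0)) g := by
  have hd : ∀ p, ((homComplex (cechResolution x) M).d (p + 1) p).hom =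
      LinearMap.lcomp R M (koszulCoD (mulXSubU x) p) := by
    intro p
    change LinearMap.lcomp R M ((cechResolution x).d p (p + 1)).hom = _
    have : (cechResolution x).d p (p + 1) = ModuleCat.ofHom (koszulCoD (mulXSubU x) p) := by
      simp only [cechResolution, koszulCocomplex, CochainComplex.of_d]
    rw [this]
    rfl
  rw [isLeftResolution_iff]
  simp only [hd]
  exact Iff.rfl

theorem isLeftResolution_homComplex_iff (x : Fin r → R) (M : Type (max u v)) [AddCommGroup M]
    [Module R M] (N : Type (max u v)) [AddCommGroup N] [Module R N] :
    IsLeftResolution (homComplex (cechResolution x) M) N ↔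
      (∀ p, ∀ a : Finset (Fin r) → (Fin r → ℕ) → M,
        (∀ T : Finset (Fin r), T.card = p → seriesD M x a T = 0) →
        ∃ b, ∀ S : Finset (Fin r), S.card = p + 1 → a S = seriesD M x b S) ∧
      ∃ g : ((Fin r → ℕ) → M) →ₗ[R] N, Function.Surjective g ∧
        LinearMap.ker g = boundaries M x := by
  rw [isLeftResolution_homComplex_iff_exact.{u, v}]
  refine and_congr (forall_congr' fun p => ?_) ?_
  · constructor
    · intro H a ha
      obtain ⟨g, hg⟩ := exists_homCoeff (R := R) (p + 1) a
      obtain ⟨b, hb⟩ := (range_lcomp_koszulCoD_iff x g).mp <| (H g).mp <|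
        (lcomp_koszulCoD_eq_zero_iff x g).mpr fun T hT => by rw [totalD_congr _ hg hT, ha T hT]
      exact ⟨b, fun S hS => by rw [← hg S hS, hb S hS]⟩
    · intro H g
      refine ⟨fun hg => (range_lcomp_koszulCoD_iff x g).mpr <|
        H _ ((lcomp_koszulCoD_eq_zero_iff x g).mp hg), ?_⟩
      rintro ⟨y, rfl⟩
      change (y ∘ₗ koszulCoD (mulXSubU x) (p + 1)) ∘ₗ koszulCoD (mulXSubU x) p = 0
      rw [LinearMap.comp_assoc, koszulCoD_comp _ (mulXSubU_commute x), LinearMap.comp_zero]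
  · constructor
    · rintro ⟨g, h1, h2⟩
      refine ⟨g ∘ₗ (homEquivSeries R r M).symm.toLinearMap,
        h1.comp (homEquivSeries R r M).symm.surjective, Submodule.ext fun f => ?_⟩
      rw [← (homEquivSeries R r M).apply_symm_apply f, homEquivSeries_mem_boundaries_iff,
        LinearMap.mem_ker, LinearMap.comp_apply]
      simp only [LinearEquiv.coe_coe, LinearEquiv.symm_apply_apply]
      exact h2 _
    · rintro ⟨g, h1, h2⟩
      refine ⟨g ∘ₗ (homEquivSeries R r M).toLinearMap,
        h1.comp (homEquivSeries R r M).surjective, fun f => ?_⟩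
      refine Iff.trans ?_ (homEquivSeries_mem_boundaries_iff x f)
      rw [← h2]
      exact Iff.rfl

theorem IsWeaklyProregular.isLeftResolution {x : Fin r → R} (h : IsWeaklyProregular x R)
    (M : Type (max u v)) [AddCommGroup M] [Module R M] [Module.Free R M] :
    IsLeftResolution (homComplex (cechResolution x) M) (completion x M) := by
  have hM : ∀ p, SeriesProZero x M p := fun p =>
    ((isWeaklyProregular_iff x).mp h p).of_free.seriesProZero
  rw [isLeftResolution_homComplex_iff.{u, v}]
  refine ⟨fun p a ha => (hM (p + 1)).exists_seriesD_eq a fun n => ?_, evalSeries M x,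
    evalSeries_surjective x, le_antisymm (fun f hf => (hM 0).mem_boundaries hf)
      fun f hf => evalSeries_boundaries x hf⟩
  -- Pro-vanishing in degree `p + 1` makes a cycle a boundary modulo each truncation; pro-vanishing
  -- in degree `p + 2` lets the primitives be glued.
  obtain ⟨m, -, H⟩ := hM p n
  exact H a fun T hT α _ => by rw [ha T hT]; rfl

/-- Only the kernel of the augmentation `g` matters: separatedness of the completion supplies the
degree `0` input of `seriesProZero_of_limit`, and acyclicity supplies the rest. -/
theorem IsWeaklyProregular.of_isLeftResolution {x : Fin r → R} {M : Type (max u v)}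
    [AddCommGroup M] [Module R M] (e : M ≃ₗ[R] (ℕ →₀ R))
    (h : IsLeftResolution (homComplex (cechResolution x) M) (completion x M)) :
    IsWeaklyProregular x R := by
  rw [isLeftResolution_homComplex_iff.{u, v}] at h
  obtain ⟨h1, g, -, h3⟩ := h
  rw [isWeaklyProregular_iff]
  refine fun p => (seriesProZero_of_limit e (h1 p) ?_).koszulProZero
  intro a ha hn
  cases p with
  | zero =>
    obtain ⟨b, hb⟩ := (mem_boundaries_iff x (a ∅)).mp <| mem_boundaries_of_inBox x g h3 fun n => by
      obtain ⟨b, hb⟩ := hn n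
      exact ⟨b, hb ∅ Finset.card_empty⟩
    refine ⟨b, fun S hS => ?_⟩
    rw [Finset.card_eq_zero.mp hS, hb]
  | succ p => exact h1 p a fun T hT => ha T (by rw [hT])

end LeftResolution

end WeakProreg

theorem corollary3p7 {R : Type u} [CommRing R] {r : ℕ} (x : Fin r → R) :
    List.TFAE [
      WeakProreg.IsWeaklyProregular x R,
      ∀ (M : Type (max u v)) [AddCommGroup M] [Module R M] [Module.Free R M],
        WeakProreg.IsLeftResolution
          (WeakProreg.homComplex (WeakProreg.cechResolution x) M) (WeakProreg.completion x M),
      WeakProreg.IsLeftResolution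
        (WeakProreg.homComplex (WeakProreg.cechResolution x) (Polynomial R))
        (WeakProreg.completion x (Polynomial R))] := by
  have e : Polynomial R ≃ₗ[R] (ℕ →₀ R) := (Polynomial.basisMonomials R).repr
  tfae_have 1 → 2 := fun h M _ _ _ =>
    WeakProreg.IsWeaklyProregular.isLeftResolution.{u, v} h M
  tfae_have 1 → 3 := fun h =>
    WeakProreg.IsWeaklyProregular.isLeftResolution.{u, u} h (Polynomial R)
  tfae_have 2 → 1 := fun h =>
    -- `R[T]` is lifted to the universe over which the free modules range.
    WeakProreg.IsWeaklyProregular.of_isLeftResolution.{u, v}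
      (ULift.moduleEquiv ≪≫ₗ e) (h (ULift.{v} (Polynomial R)))
  tfae_have 3 → 1 := fun h =>
    WeakProreg.IsWeaklyProregular.of_isLeftResolution.{u, u} e h
  tfae_finish
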